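/- Let $\Omega=[a,b]$, $a<b$, with periodic boundary conditions, let $k\ge 0$ and $q\ge 1$ be integers, $\gamma=\lfloor q/2\rfloor$, and let $\theta_1,\dots,\theta_\gamma\in\mathbb R\setminus\{\tfrac12\}$, and $\theta_0\in\mathbb R\setminus\{\tfrac12\}$ if $q$ is odd. For a mesh $a=x_{1/2}<x_{3/2}<\dots<x_{N+1/2}=b$, $N\ge 1$, with cells $I_j=[x_{j-1/2},x_{j+1/2}]$ and mesh size $h=\max_j|I_j|$, which is quasi-uniform, i.e. $h\le\sigma|I_j|$ for all $j$, let $V_h=\{v\in L^2(\Omega): v|_{I_j}\in P^k(I_j)\ \forall j\}$ and $Z_h=\{v\in V_h:\langle v,1\rangle=0\}$, where $\langle\cdot,\cdot\rangle$ and $\|\cdot\|$ are the inner product and the norm of $L^2(\Omega)$, and let $\Pi_0$ be the $L^2$ projection onto $V_h$. For $\theta\in\mathbb R$ define $D_{h,\theta}:V_h\to V_h$ by $$\langle D_{h,\theta}w_h,v_h\rangle=-\sum_j\int_{I_j} w_h\,\partial_xv_h\,dx-\sum_{j=1}^N\bigl(\theta w_h^-+(1-\theta)w_h^+\bigr)_{j+\frac12}\,(v_h^+-v_h^-)_{j+\frac12}\qquad\forall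 v_h\in V_h,$$ where $v^\mp$ are the left and right limits, extended periodically at $x_{N+1/2}\sim x_{1/2}$. For constant $\beta\in\mathbb R$ let $L=\beta\partial_x^q$, $K_h=D_{h,\theta_1}\cdots D_{h,\theta_\gamma}$, let $K_h^\top$ be the transpose of $K_h$ with respect to $\langle\cdot,\cdot\rangle$, and let $$L_h=\begin{cases}(-1)^\gamma\beta K_h^\top K_h,& q=2\gamma,\\ (-1)^\gamma\beta K_h^\top D_{h,\theta_0}K_h,& q=2\gamma+1.\end{cases}$$ Then $D_{h,\theta}:Z_h\to Z_h$ is a bijection for every $\theta\ne\frac12$; denote its inverse by $D_{h,\theta}^{-1}$. For every $w$ in the periodic Sobolev space $H^{k+1+q}(\Omega)$, $\Pi_0\partial_x^qw\in Z_h$, so that $$\Pi w=\begin{cases}(D_{h,\theta_\gamma}^{-1}\cdots D_{h,\theta_1}^{-1})(D_{h,1-\theta_1}^{-1}\cdots D_{h,1-\theta_\gamma}^{-1})\Pi_0\partial_x^qw+\frac{\langle w,1\rangle}{\langle 1,1\rangle},&q=2\gamma,\\[2pt](D_{h,\theta_\gamma}^{-1}\cdots D_{h,\theta_1}^{-1})D_{h,\theta_0}^{-1}(D_{h,1-\theta_1}^{-1}\cdots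 D_{h,1-\theta_\gamma}^{-1})\Pi_0\partial_x^qw+\frac{\langle w,1\rangle}{\langle 1,1\rangle},&q=2\gamma+1\end{cases}$$ is well defined, and $$\|w-\Pi w\|\le C\,\|w\|_{k+1+q}\,h^{k+1},$$ where $\|\cdot\|_{m}$ is the $H^m(\Omega)$ norm and $C>0$ depends only on $\Omega$, $k$, $q$, the $\theta_i$ and $\sigma$, not on the mesh or $w$. Moreover $L_h\Pi w=\Pi_0Lw$ for every $\beta$; hence $\langle (L-L_h\Pi)w,v_h\rangle=0$ for all $v_h\in V_h$. -/

import Mathlib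

open MeasureTheory Polynomial

noncomputable section

namespace LDG

/-- A partition `a = x_{1/2} < x_{3/2} < ... < x_{N+1/2} = b` of `Ω = [a, b]` into `N` cells;
`node j` is `x_{j+1/2}`, `j = 0, ..., N`. -/
structure Mesh (a b : ℝ) (N : ℕ) where
  node : Fin (N + 1) → ℝ
  strictMono_node : StrictMono node
  node_zero : node 0 = a
  node_last : node (Fin.last N) = b

/-- The discontinuous finite element space `V_h`: a polynomial of degree at most `k` on each of
the `N` cells. The associated function on `Ω` is `Mesh.toFun` below. -/
abbrev DGSpace (N k : ℕ) : Type := Fin N → degreeLT ℝ (k + 1)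

namespace Mesh

variable {a b : ℝ} {N : ℕ} (M : Mesh a b N)

/-- Left end point of the cell `I_j`. -/
def left (j : Fin N) : ℝ := M.node j.castSucc

/-- Right end point of the cell `I_j`. -/
def right (j : Fin N) : ℝ := M.node j.succ

/-- The length of the cell `I_j`. -/
def width (j : Fin N) : ℝ := M.right j - M.left j

/-- The mesh size `h = max_j |I_j|`. -/
def size [NeZero N] : ℝ := Finset.univ.sup' Finset.univ_nonempty M.width

/-- Quasi-uniformity with constant `σ`: `h ≤ σ |I_j|` for all `j`. -/
def QuasiUniform [NeZero N] (σ : ℝ) : Prop := ∀ j, M.size ≤ σ * M.width j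

theorem left_lt_right (j : Fin N) : M.left j < M.right j :=
  M.strictMono_node Fin.castSucc_lt_succ

variable {k : ℕ}

/-- The piecewise polynomial function on `Ω` given by an element of `V_h` (the value at an
interior node, which is irrelevant in `L²`, is taken from the right). -/
def toFun (v : DGSpace N k) (x : ℝ) : ℝ :=
  ∑ j, (Set.Ico (M.left j) (M.right j)).indicator (fun y => (v j : ℝ[X]).eval y) x

/-- The `L²(Ω)` inner product on `V_h`, `⟨v, w⟩ = ∑_j ∫_{I_j} v w`. -/
def inner : LinearMap.BilinForm ℝ (DGSpace N k) :=
  LinearMap.mk₂ ℝ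
    (fun v w => ∑ j, ∫ x in M.left j..M.right j, (v j : ℝ[X]).eval x * (w j : ℝ[X]).eval x)
    (fun v v' w => by
      rw [← Finset.sum_add_distrib]
      refine Finset.sum_congr rfl fun j _ => ?_
      rw [← intervalIntegral.integral_add (Continuous.intervalIntegrable (by fun_prop) _ _)
        (Continuous.intervalIntegrable (by fun_prop) _ _)]
      simp [add_mul])
    (fun c v w => by
      rw [smul_eq_mul, Finset.mul_sum]
      refine Finset.sum_congr rfl fun j _ => ?_
      rw [← intervalIntegral.integral_const_mul]
      simp [mul_assoc])
    (fun v w w' => by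
      rw [← Finset.sum_add_distrib]
      refine Finset.sum_congr rfl fun j _ => ?_
      rw [← intervalIntegral.integral_add (Continuous.intervalIntegrable (by fun_prop) _ _)
        (Continuous.intervalIntegrable (by fun_prop) _ _)]
      simp [mul_add])
    (fun c v w => by
      rw [smul_eq_mul, Finset.mul_sum]
      refine Finset.sum_congr rfl fun j _ => ?_
      rw [← intervalIntegral.integral_const_mul]
      simp [mul_left_comm])

theorem inner_apply (v w : DGSpace N k) :
    M.inner v w =
      ∑ j, ∫ x in M.left j..M.right j, (v j : ℝ[X]).eval x * (w j : ℝ[X]).eval x := rfl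

theorem inner_self_eq_zero {v : DGSpace N k} (h : M.inner v v = 0) : v = 0 := by
  rw [inner_apply, Finset.sum_eq_zero_iff_of_nonneg] at h
  · funext j
    have hj := h j (Finset.mem_univ j)
    have hlt := M.left_lt_right j
    by_contra hne
    have hp : (v j : ℝ[X]) ≠ 0 := fun h0 => hne (Subtype.ext h0)
    have hinf : (Set.Ioo (M.left j) (M.right j)).Infinite := Set.Ioo_infinite hlt
    obtain ⟨c, hc, hc0⟩ : ∃ c ∈ Set.Ioo (M.left j) (M.right j), (v j : ℝ[X]).eval c ≠ 0 := by
      by_contra! hall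
      exact hp (Polynomial.eq_zero_of_infinite_isRoot _ (hinf.mono fun c hc => hall c hc))
    have hpos : 0 < ∫ x in M.left j..M.right j, (v j : ℝ[X]).eval x * (v j : ℝ[X]).eval x :=
      intervalIntegral.integral_pos hlt (Continuous.continuousOn (by fun_prop))
        (fun x _ => mul_self_nonneg _) ⟨c, Set.Ioo_subset_Icc_self hc, mul_self_pos.2 hc0⟩
    exact hpos.ne' hj
  · intro j _
    exact intervalIntegral.integral_nonneg (M.left_lt_right j).le fun x _ => mul_self_nonneg _

theorem inner_nondegenerate : (M.inner (k := k)).Nondegenerate :=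
  ⟨fun _ hv => M.inner_self_eq_zero (hv _), fun _ hv => M.inner_self_eq_zero (hv _)⟩

/-- `Z_h`, the elements of `V_h` of mean zero. -/
def zeroMean : Set (DGSpace N k) :=
  {v | ∑ j, ∫ x in M.left j..M.right j, (v j : ℝ[X]).eval x = 0}

theorem intervalIntegrable_cell {f : ℝ → ℝ} (hf : IntervalIntegrable f volume a b) (j : Fin N) :
    IntervalIntegrable f volume (M.left j) (M.right j) := by
  have h0 : a ≤ M.left j :=
    M.node_zero.symm.le.trans (M.strictMono_node.monotone (Fin.zero_le _))
  have h1 : M.right j ≤ b :=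
    (M.strictMono_node.monotone (Fin.le_last _)).trans M.node_last.le
  have h2 := (M.left_lt_right j).le
  refine hf.mono_set ?_
  rw [Set.uIcc_of_le h2, Set.uIcc_of_le (h0.trans (h2.trans h1))]
  exact Set.Icc_subset_Icc h0 h1

/-- The functional `v ↦ ⟨f, v⟩ = ∑_j ∫_{I_j} f v` on `V_h`, for `f` integrable on `Ω`. -/
def moment (f : ℝ → ℝ) (hf : IntervalIntegrable f volume a b) :
    Module.Dual ℝ (DGSpace N k) where
  toFun v := ∑ j, ∫ x in M.left j..M.right j, f x * (v j : ℝ[X]).eval x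
  map_add' v w := by
    rw [← Finset.sum_add_distrib]
    refine Finset.sum_congr rfl fun j _ => ?_
    have hj := M.intervalIntegrable_cell hf j
    rw [← intervalIntegral.integral_add
      (hj.mul_continuousOn (Continuous.continuousOn (by fun_prop)))
      (hj.mul_continuousOn (Continuous.continuousOn (by fun_prop)))]
    simp [mul_add]
  map_smul' c v := by
    rw [RingHom.id_apply, smul_eq_mul, Finset.mul_sum]
    refine Finset.sum_congr rfl fun j _ => ?_
    rw [← intervalIntegral.integral_const_mul]
    simp [mul_left_comm]

open Classical in
/-- The `L²` projection `Π₀` onto `V_h`: `⟨Π₀ f, v⟩ = ⟨f, v⟩` for all `v ∈ V_h`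
(with value `0` for `f` not integrable on `Ω`). -/
def proj₀ (k : ℕ) (f : ℝ → ℝ) : DGSpace N k :=
  if hf : IntervalIntegrable f volume a b then
    (M.inner.toDual M.inner_nondegenerate).symm (M.moment f hf)
  else 0

/-- The constant function `c` as an element of `V_h`. -/
def const (N k : ℕ) (c : ℝ) : DGSpace N k := fun _ =>
  ⟨C c, mem_degreeLT.2 (degree_C_le.trans_lt (by exact_mod_cast Nat.succ_pos k))⟩

section Periodic

variable [NeZero N]

/-- The left limit `v⁻` at the right end point `x_{j+1/2}` of the cell `I_j`. -/
def traceMinus (j : Fin N) (v : DGSpace N k) : ℝ := (v j : ℝ[X]).eval (M.right j)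

/-- The right limit `v⁺` at the right end point `x_{j+1/2}` of the cell `I_j`. By periodicity the
cell to the right of the last one is the first one: the sum `j + 1` in `Fin N` is cyclic. -/
def tracePlus (j : Fin N) (v : DGSpace N k) : ℝ := (v (j + 1) : ℝ[X]).eval (M.left (j + 1))

/-- The jump `[v] = v⁺ - v⁻` at `x_{j+1/2}`. -/
def jump (j : Fin N) (v : DGSpace N k) : ℝ := M.tracePlus j v - M.traceMinus j v

/-- The numerical flux `θ w⁻ + (1 - θ) w⁺` at `x_{j+1/2}`. -/
def flux (θ : ℝ) (j : Fin N) (w : DGSpace N k) : ℝ :=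
  θ * M.traceMinus j w + (1 - θ) * M.tracePlus j w

/-- The DG bilinear form `(w, v) ↦ -⟨w, ∂ₓ v⟩ - ∑_j ŵ_{j+1/2} [v]_{j+1/2}`. -/
def dgForm (θ : ℝ) : LinearMap.BilinForm ℝ (DGSpace N k) :=
  LinearMap.mk₂ ℝ
    (fun w v =>
      -(∑ j, ∫ x in M.left j..M.right j, (w j : ℝ[X]).eval x * (derivative (v j : ℝ[X])).eval x)
        - ∑ j, M.flux θ j w * M.jump j v)
    (fun w w' v => by
      have h : ∀ j, (∫ x in M.left j..M.right j,
          ((w + w') j : ℝ[X]).eval x * (derivative (v j : ℝ[X])).eval x) =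
          (∫ x in M.left j..M.right j, (w j : ℝ[X]).eval x * (derivative (v j : ℝ[X])).eval x) +
          ∫ x in M.left j..M.right j,
            (w' j : ℝ[X]).eval x * (derivative (v j : ℝ[X])).eval x := fun j => by
        rw [← intervalIntegral.integral_add (Continuous.intervalIntegrable (by fun_prop) _ _)
          (Continuous.intervalIntegrable (by fun_prop) _ _)]
        simp [add_mul]
      have h' : ∀ j, M.flux θ j (w + w') * M.jump j v =
          M.flux θ j w * M.jump j v + M.flux θ j w' * M.jump j v := fun j => by
        simp [flux, traceMinus, tracePlus]; ring
      simp only [h, h', Finset.sum_add_distrib]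
      ring)
    (fun c w v => by
      have h : ∀ j, (∫ x in M.left j..M.right j,
          ((c • w) j : ℝ[X]).eval x * (derivative (v j : ℝ[X])).eval x) =
          c * ∫ x in M.left j..M.right j,
            (w j : ℝ[X]).eval x * (derivative (v j : ℝ[X])).eval x := fun j => by
        rw [← intervalIntegral.integral_const_mul]
        simp [mul_assoc]
      have h' : ∀ j, M.flux θ j (c • w) * M.jump j v =
          c * (M.flux θ j w * M.jump j v) := fun j => by
        simp [flux, traceMinus, tracePlus]; ring
      simp only [h, h', ← Finset.mul_sum, smul_eq_mul]
      ring)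
    (fun w v v' => by
      have h : ∀ j, (∫ x in M.left j..M.right j,
          (w j : ℝ[X]).eval x * (derivative ((v + v') j : ℝ[X])).eval x) =
          (∫ x in M.left j..M.right j, (w j : ℝ[X]).eval x * (derivative (v j : ℝ[X])).eval x) +
          ∫ x in M.left j..M.right j,
            (w j : ℝ[X]).eval x * (derivative (v' j : ℝ[X])).eval x := fun j => by
        rw [← intervalIntegral.integral_add (Continuous.intervalIntegrable (by fun_prop) _ _)
          (Continuous.intervalIntegrable (by fun_prop) _ _)]
        simp [mul_add]
      have h' : ∀ j, M.flux θ j w * M.jump j (v + v') =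
          M.flux θ j w * M.jump j v + M.flux θ j w * M.jump j v' := fun j => by
        simp [jump, traceMinus, tracePlus]; ring
      simp only [h, h', Finset.sum_add_distrib]
      ring)
    (fun c w v => by
      have h : ∀ j, (∫ x in M.left j..M.right j,
          (w j : ℝ[X]).eval x * (derivative ((c • v) j : ℝ[X])).eval x) =
          c * ∫ x in M.left j..M.right j,
            (w j : ℝ[X]).eval x * (derivative (v j : ℝ[X])).eval x := fun j => by
        rw [← intervalIntegral.integral_const_mul]
        simp [mul_left_comm]
      have h' : ∀ j, M.flux θ j w * M.jump j (c • v) =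
          c * (M.flux θ j w * M.jump j v) := fun j => by
        simp [jump, traceMinus, tracePlus]; ring
      simp only [h, h', ← Finset.mul_sum, smul_eq_mul]
      ring)

/-- The DG operator `D_{h,θ} : V_h → V_h`, `⟨D_{h,θ} w, v⟩ = dgForm θ w v` for all `v ∈ V_h`. -/
def D (k : ℕ) (θ : ℝ) : DGSpace N k →ₗ[ℝ] DGSpace N k :=
  (M.inner.toDual M.inner_nondegenerate).symm.toLinearMap ∘ₗ M.dgForm θ

theorem inner_D (θ : ℝ) (w v : DGSpace N k) : M.inner (M.D k θ w) v = M.dgForm θ w v :=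
  LinearMap.BilinForm.apply_toDual_symm_apply (hB := M.inner_nondegenerate) _ _

/-- The inverse `D_{h,θ}⁻¹` of `D_{h,θ} : Z_h → Z_h`. -/
def Dinv (k : ℕ) (θ : ℝ) : DGSpace N k → DGSpace N k :=
  Function.invFunOn (M.D k θ) M.zeroMean

/-- The list `[θ₁, ..., θ_γ]`. -/
def thetaList (θ : ℕ → ℝ) (γ : ℕ) : List ℝ := (List.range' 1 γ).map θ

/-- `K_h = D_{h,θ₁} D_{h,θ₂} ⋯ D_{h,θ_γ}`. -/
def K (k γ : ℕ) (θ : ℕ → ℝ) : Module.End ℝ (DGSpace N k) :=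
  ((thetaList θ γ).map (M.D k)).prod

/-- The transpose with respect to the `L²` inner product of `V_h`. -/
def transpose (A : Module.End ℝ (DGSpace N k)) : Module.End ℝ (DGSpace N k) :=
  M.inner.leftAdjointOfNondegenerate M.inner_nondegenerate A

open Classical in
/-- The discrete operator `L_h` of the LDG scheme for `∂_t u = β ∂ₓ^q u`:
`(-1)^γ β K_hᵀ K_h` if `q = 2γ`, and `(-1)^γ β K_hᵀ D_{h,θ₀} K_h` if `q = 2γ + 1`. -/
def Lh (k q : ℕ) (β : ℝ) (θ : ℕ → ℝ) : Module.End ℝ (DGSpace N k) :=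
  ((-1) ^ (q / 2) * β) •
    (if Even q then M.transpose (M.K k (q / 2) θ) * M.K k (q / 2) θ
      else M.transpose (M.K k (q / 2) θ) * M.D k (θ 0) * M.K k (q / 2) θ)

/-- `(D_{h,θ_γ}⁻¹ ⋯ D_{h,θ₁}⁻¹) z`. -/
def outerInv (k γ : ℕ) (θ : ℕ → ℝ) (z : DGSpace N k) : DGSpace N k :=
  (thetaList θ γ).foldl (fun y t => M.Dinv k t y) z

/-- `(D_{h,1-θ₁}⁻¹ ⋯ D_{h,1-θ_γ}⁻¹) z`. -/
def innerInv (k γ : ℕ) (θ : ℕ → ℝ) (z : DGSpace N k) : DGSpace N k :=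
  (thetaList θ γ).foldr (fun t y => M.Dinv k (1 - t) y) z

open Classical in
/-- The operator `Π`. -/
def ldgProj (k q : ℕ) (θ : ℕ → ℝ) (w : ℝ → ℝ) : DGSpace N k :=
  (if Even q then
      M.outerInv k (q / 2) θ (M.innerInv k (q / 2) θ (M.proj₀ k (iteratedDeriv q w)))
    else
      M.outerInv k (q / 2) θ
        (M.Dinv k (θ 0) (M.innerInv k (q / 2) θ (M.proj₀ k (iteratedDeriv q w)))))
  + const N k ((∫ x in a..b, w x) / ∫ _x in a..b, (1 : ℝ))

end Periodic

end Mesh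

/-- The `L²(a, b)` norm. -/
def l2norm (a b : ℝ) (f : ℝ → ℝ) : ℝ := √(∫ x in a..b, f x ^ 2)

/-- Membership in the periodic Sobolev space `H^m` on `[a, b]`, for the continuously
differentiable representative: `w` is `(b - a)`-periodic and `C^{m-1}`, its derivatives of order
less than `m` are absolutely continuous on `[a, b]`, and those of order at most `m` are in
`L²(a, b)`. -/
structure MemPeriodicSobolev (a b : ℝ) (m : ℕ) (w : ℝ → ℝ) : Prop where
  periodic : Function.Periodic w (b - a)
  contDiff : ∀ i : ℕ, i < m → ContDiff ℝ i w
  absCont : ∀ i : ℕ, i < m → AbsolutelyContinuousOnInterval (iteratedDeriv i w) a b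
  memLp : ∀ i : ℕ, i ≤ m → MemLp (iteratedDeriv i w) 2 (volume.restrict (Set.Ioc a b))

/-- The Sobolev norm `‖w‖_m = (∑_{i ≤ m} ‖∂ₓ^i w‖²)^{1/2}`. -/
def sobolevNorm (a b : ℝ) (m : ℕ) (w : ℝ → ℝ) : ℝ :=
  √(∑ i ∈ Finset.range (m + 1), l2norm a b (iteratedDeriv i w) ^ 2)

/-- The differential operator `L w = β ∂ₓ^q w`. -/
def diffOp (β : ℝ) (q : ℕ) (w : ℝ → ℝ) (x : ℝ) : ℝ := β * iteratedDeriv q w x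

end LDG

end

/-!
The Gauss-Radau projection attached to the flux parameter `θ` keeps the moments of degree `< k` and
the `θ`-averages at the nodes, so that it intertwines `D_{h,θ}` with `∂ₓ`: it maps `u` to some `p`
with `D_{h,θ} p = Π₀ u'`. Its difference from `Π₀ u` is a multiple of the `k`-th Legendre polynomial
on every cell, and the multiples solve the cyclic two-term recursion with coefficients `θ` and
`±(1 - θ)`, which is solvable uniformly in the mesh because `|θ| ≠ |1 - θ|`.

Applied to a primitive of `z ∈ Z_h`, this projection yields a preimage of `z` under `D_{h,θ}` with
norm `O(‖z‖)`; hence `D_{h,θ}` is onto `Z_h`, it is injective there because its adjoint is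
`-D_{h,1-θ}`, and `D_{h,θ}⁻¹` is bounded uniformly in the mesh. Consequently each inverse in `Π`
turns an approximation of `Π₀ u'` into one of `Π₀ u` (up to the mean) with an additional error
`O(h^{k+1})`. Finally `L_h` is `β` times the product of the operators inverted by `Π`, since
transposing `K_h` reverses its factors and turns each `D_{h,θ}` into `-D_{h,1-θ}`.
-/

noncomputable section

namespace LDG

/-! ### Legendre polynomials on an interval -/

theorem degree_derivative_lt_of_lt_succ {p : ℝ[X]} {n : ℕ} (hp : p.degree < (n + 1 : ℕ)) :
    (derivative p).degree < n := by
  rw [degree_lt_iff_coeff_zero] at hp ⊢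
  intro i hi
  rw [coeff_derivative, hp (i + 1) (by lia), zero_mul]

theorem integral_eval_mul_derivative (p q : ℝ[X]) (l r : ℝ) :
    ∫ x in l..r, p.eval x * (derivative q).eval x =
      p.eval r * q.eval r - p.eval l * q.eval l -
        ∫ x in l..r, (derivative p).eval x * q.eval x :=
  intervalIntegral.integral_mul_deriv_eq_deriv_mul
    (fun x _ => p.hasDerivAt x) (fun x _ => q.hasDerivAt x)
    (Continuous.intervalIntegrable (by fun_prop) _ _)
    (Continuous.intervalIntegrable (by fun_prop) _ _)

theorem integral_eval_mul_iterate_derivative_eq_zero {n : ℕ} {p W : ℝ[X]} {l r : ℝ}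
    (hp : p.degree < n) (hl : ∀ i < n, (derivative^[i] W).eval l = 0)
    (hr : ∀ i < n, (derivative^[i] W).eval r = 0) :
    ∫ x in l..r, p.eval x * (derivative^[n] W).eval x = 0 := by
  induction n generalizing p with
  | zero => simp [degree_eq_bot.1 (Nat.WithBot.lt_zero_iff.1 hp)]
  | succ n ih =>
    rw [Function.iterate_succ_apply', integral_eval_mul_derivative, hl n n.lt_succ_self,
      hr n n.lt_succ_self,
      ih (degree_derivative_lt_of_lt_succ hp) (fun i hi => hl i (by lia))
        (fun i hi => hr i (by lia))]
    ring

theorem eval_iterate_derivative_X_sub_C_pow_mul_self (p : ℝ[X]) (n : ℕ) (c : ℝ) :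
    (derivative^[n] ((X - C c) ^ n * p)).eval c = n.factorial * p.eval c := by
  have h := aeval_iterate_derivative_self ((X - C c) ^ n * p) n c (p' := p) (by simp)
  rwa [coe_aeval_eq_eval, nsmul_eq_mul] at h

theorem eval_iterate_derivative_X_sub_C_pow_mul_of_lt (p : ℝ[X]) {i n : ℕ} (hi : i < n) (c : ℝ) :
    (derivative^[i] ((X - C c) ^ n * p)).eval c = 0 := by
  have h := aeval_iterate_derivative_of_lt ((X - C c) ^ n * p) n c (p' := p) (by simp) hi
  rwa [coe_aeval_eq_eval] at h

/-- The Legendre polynomial of degree `n` on `[l, r]`, normalised to the value `1` at `r` and given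
by the Rodrigues formula. -/
def legendre (n : ℕ) (l r : ℝ) : ℝ[X] :=
  C (n.factorial * (r - l) ^ n)⁻¹ * derivative^[n] ((X - C l) ^ n * (X - C r) ^ n)

theorem degree_X_sub_C_mul_derivative_sub_lt {p : ℝ[X]} {n : ℕ} (hp : p.degree < (n + 1 : ℕ))
    (c : ℝ) : ((X - C c) * derivative p - C (n : ℝ) * p).degree < (n : WithBot ℕ) := by
  rw [degree_lt_iff_coeff_zero] at hp ⊢
  intro i hi
  have hnext := hp (i + 1) (by lia)
  have hcoeff : ((i : ℝ) - n) * p.coeff i = 0 := by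
    rcases hi.eq_or_lt with rfl | h
    · simp
    · rw [hp i h, mul_zero]
  cases i with
  | zero => simpa [sub_mul, coeff_derivative, hnext] using hcoeff
  | succ i =>
    simp only [coeff_sub, sub_mul, coeff_X_mul, coeff_C_mul, coeff_derivative, hnext]
    push_cast at hcoeff
    linear_combination hcoeff

section Legendre

variable (n : ℕ) {l r : ℝ}

theorem legendre_eval_right (hlr : l < r) : (legendre n l r).eval r = 1 := by
  have := sub_pos.2 hlr
  rw [legendre, eval_mul, eval_C, mul_comm ((X - C l) ^ n),
    eval_iterate_derivative_X_sub_C_pow_mul_self, eval_pow, eval_sub, eval_X, eval_C,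
    inv_mul_cancel₀ (by positivity)]

theorem legendre_eval_left (hlr : l < r) : (legendre n l r).eval l = (-1) ^ n := by
  have := sub_pos.2 hlr
  rw [legendre, eval_mul, eval_C, eval_iterate_derivative_X_sub_C_pow_mul_self, eval_pow, eval_sub,
    eval_X, eval_C, ← neg_sub r l, neg_pow]
  field_simp

theorem degree_legendre_lt (l r : ℝ) : (legendre n l r).degree < (n + 1 : ℕ) := by
  refine lt_of_le_of_lt degree_le_natDegree ?_
  rw [Nat.cast_lt, Nat.lt_succ_iff]
  refine (natDegree_C_mul_le _ _).trans
    ((natDegree_iterate_derivative _ _).trans (Nat.sub_le_of_le_add ?_))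
  exact natDegree_mul_le.trans (add_le_add (by simp) (by simp))

theorem integral_eval_mul_legendre_eq_zero {n : ℕ} {p : ℝ[X]} (hp : p.degree < n) (l r : ℝ) :
    ∫ x in l..r, p.eval x * (legendre n l r).eval x = 0 := by
  have hzero := integral_eval_mul_iterate_derivative_eq_zero (l := l) (r := r) hp
    (fun i hi => eval_iterate_derivative_X_sub_C_pow_mul_of_lt ((X - C r) ^ n) hi l)
    (fun i hi => by
      rw [mul_comm]
      exact eval_iterate_derivative_X_sub_C_pow_mul_of_lt ((X - C l) ^ n) hi r)
  simp only [legendre, eval_mul, eval_C, mul_left_comm _ (_ : ℝ)⁻¹,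
    intervalIntegral.integral_const_mul, hzero, mul_zero]

-- Integrate `((x - l) L²)' = L² + 2 (x - l) L' L` and replace `(x - l) L'` by `n L`, up to a
-- polynomial of degree less than `n`.
theorem integral_legendre_mul_self (hlr : l < r) :
    ∫ x in l..r, (legendre n l r).eval x * (legendre n l r).eval x = (r - l) / (2 * n + 1) := by
  have hLr := legendre_eval_right n hlr
  have hdeg := degree_X_sub_C_mul_derivative_sub_lt (degree_legendre_lt n l r) l
  set L := legendre n l r
  have horth : ∫ x in l..r, ((X - C l) * derivative L - C (n : ℝ) * L).eval x * L.eval x = 0 :=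
    integral_eval_mul_legendre_eq_zero hdeg l r
  have hreduce : ∫ x in l..r, (x - l) * (derivative L).eval x * L.eval x =
      n * ∫ x in l..r, L.eval x * L.eval x := by
    rw [← intervalIntegral.integral_const_mul, ← sub_eq_zero, ← intervalIntegral.integral_sub
      (Continuous.intervalIntegrable (by fun_prop) _ _)
      (Continuous.intervalIntegrable (by fun_prop) _ _), ← horth]
    congr 1 with x
    simp only [eval_sub, eval_mul, eval_X, eval_C]
    ring
  have hparts := integral_eval_mul_derivative ((X - C l) * L) L l r
  have hsplit : ∫ x in l..r, (derivative ((X - C l) * L)).eval x * L.eval x =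
      (∫ x in l..r, L.eval x * L.eval x) +
        ∫ x in l..r, (x - l) * (derivative L).eval x * L.eval x := by
    rw [← intervalIntegral.integral_add (Continuous.intervalIntegrable (by fun_prop) _ _)
      (Continuous.intervalIntegrable (by fun_prop) _ _)]
    congr 1 with x
    simp only [derivative_mul, derivative_sub, derivative_X, derivative_C, sub_zero, one_mul,
      eval_add, eval_sub, eval_mul, eval_X, eval_C]
    ring
  have hcomm : ∫ x in l..r, ((X - C l) * L).eval x * (derivative L).eval x =
      ∫ x in l..r, (x - l) * (derivative L).eval x * L.eval x := by
    congr 1 with x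
    simp only [eval_sub, eval_mul, eval_X, eval_C]
    ring
  rw [hsplit, hcomm, hreduce, hLr] at hparts
  simp only [eval_mul, eval_sub, eval_X, eval_C, hLr] at hparts
  rw [eq_div_iff (by positivity)]
  linear_combination hparts

theorem coeff_legendre_ne_zero (hlr : l < r) : (legendre n l r).coeff n ≠ 0 := by
  intro h
  have hdeg : (legendre n l r).degree < n := by
    have hlt := (degree_lt_iff_coeff_zero _ _).1 (degree_legendre_lt n l r)
    refine (degree_lt_iff_coeff_zero _ _).2 fun i hi => ?_
    rcases hi.eq_or_lt with rfl | hi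
    exacts [h, hlt i hi]
  have hzero := integral_legendre_mul_self n hlr
  rw [integral_eval_mul_legendre_eq_zero hdeg] at hzero
  have := sub_pos.2 hlr
  exact absurd hzero (by positivity)

theorem exists_eq_add_C_mul_legendre {n : ℕ} {q : ℝ[X]} (hq : q.degree < (n + 1 : ℕ))
    (hlr : l < r) : ∃ (p : ℝ[X]) (c : ℝ), p.degree < n ∧ q = p + C c * legendre n l r := by
  refine ⟨q - C (q.coeff n / (legendre n l r).coeff n) * legendre n l r,
    q.coeff n / (legendre n l r).coeff n, ?_, by ring⟩
  have hL := (degree_lt_iff_coeff_zero _ _).1 (degree_legendre_lt n l r)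
  rw [degree_lt_iff_coeff_zero] at hq ⊢
  intro i hi
  rw [coeff_sub, coeff_C_mul]
  rcases hi.eq_or_lt with rfl | hi
  · rw [div_mul_cancel₀ _ (coeff_legendre_ne_zero n hlr), sub_self]
  · rw [hq i hi, hL i hi, mul_zero, sub_zero]

theorem integral_add_C_mul_legendre_sq {n : ℕ} {p : ℝ[X]} (hp : p.degree < n) (c : ℝ)
    (hlr : l < r) :
    ∫ x in l..r, (p + C c * legendre n l r).eval x ^ 2 =
      (∫ x in l..r, p.eval x ^ 2) + c ^ 2 * ((r - l) / (2 * n + 1)) := by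
  have hexpand : ∀ x, (p + C c * legendre n l r).eval x ^ 2 =
      p.eval x ^ 2 + 2 * c * (p.eval x * (legendre n l r).eval x) +
        c ^ 2 * ((legendre n l r).eval x * (legendre n l r).eval x) := fun x => by
    simp only [eval_add, eval_mul, eval_C]
    ring
  simp only [hexpand]
  rw [intervalIntegral.integral_add (Continuous.intervalIntegrable (by fun_prop) _ _)
      (Continuous.intervalIntegrable (by fun_prop) _ _),
    intervalIntegral.integral_add (Continuous.intervalIntegrable (by fun_prop) _ _)
      (Continuous.intervalIntegrable (by fun_prop) _ _),
    intervalIntegral.integral_const_mul, intervalIntegral.integral_const_mul,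
    integral_eval_mul_legendre_eq_zero hp, integral_legendre_mul_self n hlr, mul_zero, add_zero]

-- The sharp constant `n²` is the sum of the odd numbers `2 i + 1`, `i < n`, in the Cauchy-Schwarz
-- inequality for the Legendre coefficients.
theorem sub_mul_sq_eval_endpoint_le {n : ℕ} {q : ℝ[X]} (hq : q.degree < n) (hlr : l < r) {x : ℝ}
    (hx : x = l ∨ x = r) :
    (r - l) * q.eval x ^ 2 ≤ n ^ 2 * ∫ y in l..r, q.eval y ^ 2 := by
  induction n generalizing q with
  | zero => simp [degree_eq_bot.1 (Nat.WithBot.lt_zero_iff.1 hq)]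
  | succ n ih =>
    obtain ⟨p, c, hp, rfl⟩ := exists_eq_add_C_mul_legendre hq hlr
    have hε : (legendre n l r).eval x ^ 2 = 1 := by
      rcases hx with rfl | rfl
      · rw [legendre_eval_left n hlr, ← pow_mul, mul_comm, pow_mul, neg_one_sq, one_pow]
      · rw [legendre_eval_right n hlr, one_pow]
    rw [integral_add_C_mul_legendre_sq hp c hlr, eval_add, eval_mul, eval_C]
    have hw := sub_pos.2 hlr
    set w := r - l
    set ε := (legendre n l r).eval x
    rcases n.eq_zero_or_pos with rfl | hn
    · rw [degree_eq_bot.1 (Nat.WithBot.lt_zero_iff.1 hp)]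
      simp only [eval_zero, zero_add, mul_pow, hε]
      simp [mul_comm]
    have : (0 : ℝ) < n := Nat.cast_pos.2 hn
    have hcauchy : (p.eval x + c * ε) ^ 2 ≤
        (n + 1) ^ 2 * (p.eval x ^ 2 / n ^ 2 + c ^ 2 / (2 * n + 1)) := by
      rw [← sub_nonneg, show (n + 1) ^ 2 * (p.eval x ^ 2 / n ^ 2 + c ^ 2 / (2 * n + 1)) -
        (p.eval x + c * ε) ^ 2 =
          ((2 * n + 1) * p.eval x - n ^ 2 * (c * ε)) ^ 2 / (n ^ 2 * (2 * n + 1)) by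
        field_simp
        linear_combination (-c ^ 2 * n ^ 2 * (n + 1) ^ 2) * hε]
      positivity
    calc w * (p.eval x + c * ε) ^ 2
        ≤ w * ((n + 1) ^ 2 * (p.eval x ^ 2 / n ^ 2 + c ^ 2 / (2 * n + 1))) := by gcongr
      _ = (n + 1) ^ 2 * (w * p.eval x ^ 2 / n ^ 2 + c ^ 2 * (w / (2 * n + 1))) := by ring
      _ ≤ _ := by
          push_cast
          gcongr
          rw [div_le_iff₀' (by positivity)]
          exact ih hp

end Legendre

/-! ### Taylor approximation in the mean -/

theorem sq_intervalIntegral_le {g : ℝ → ℝ} {l r : ℝ} (hlr : l ≤ r)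
    (hg : IntervalIntegrable g volume l r)
    (hg2 : IntervalIntegrable (fun x => g x ^ 2) volume l r) :
    (∫ x in l..r, g x) ^ 2 ≤ (r - l) * ∫ x in l..r, g x ^ 2 := by
  rcases hlr.eq_or_lt with rfl | hlt
  · simp
  have hpos := sub_pos.2 hlt
  set A := ∫ x in l..r, g x with hA
  have hvar : 0 ≤ ∫ x in l..r, (g x ^ 2 - 2 * (A / (r - l)) * g x + (A / (r - l)) ^ 2) :=
    intervalIntegral.integral_nonneg hlr fun x _ => by
      linarith [sq_nonneg (g x - A / (r - l))]
  rw [intervalIntegral.integral_add (hg2.sub (hg.const_mul _)) intervalIntegrable_const,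
    intervalIntegral.integral_sub hg2 (hg.const_mul _), intervalIntegral.integral_const_mul,
    intervalIntegral.integral_const, ← hA, smul_eq_mul] at hvar
  have hcomplete : (r - l) * ∫ x in l..r, g x ^ 2 = A ^ 2 + (r - l) *
      ((∫ x in l..r, g x ^ 2) - 2 * (A / (r - l)) * A + (r - l) * (A / (r - l)) ^ 2) := by
    field_simp
    ring
  rw [hcomplete]
  exact le_add_of_nonneg_right (mul_nonneg hpos.le hvar)

theorem absolutelyContinuousOnInterval_congr {f g : ℝ → ℝ} {l r : ℝ}
    (hf : AbsolutelyContinuousOnInterval f l r) (hfg : Set.EqOn f g (Set.uIcc l r)) :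
    AbsolutelyContinuousOnInterval g l r := by
  refine Filter.Tendsto.congr' (Filter.mem_inf_of_right fun E hE => ?_) hf
  refine Finset.sum_congr rfl fun i hi => ?_
  rw [hfg (hE.1 i hi).1, hfg (hE.1 i hi).2]

theorem sub_sum_iteratedDeriv_eq_integral {f : ℝ → ℝ} {n : ℕ} {l x : ℝ} (hlx : l ≤ x)
    (hf : ContDiff ℝ n f) (hac : AbsolutelyContinuousOnInterval (iteratedDeriv n f) l x) :
    f x - ∑ i ∈ Finset.range (n + 1), iteratedDeriv i f l / i.factorial * (x - l) ^ i =
      ∫ t in l..x, (x - t) ^ n / n.factorial * iteratedDeriv (n + 1) f t := by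
  rcases hlx.eq_or_lt with rfl | hlt
  · simp [Finset.sum_range_succ']
  have hwithin : ∀ i ≤ n, Set.EqOn (iteratedDerivWithin i f (Set.uIcc l x)) (iteratedDeriv i f)
      (Set.uIcc l x) := fun i hi y hy =>
    iteratedDerivWithin_eq_iteratedDeriv (uniqueDiffOn_uIcc hlt.ne)
      (hf.of_le (by exact_mod_cast hi)).contDiffAt hy
  have htaylor := taylor_integral_remainder_of_absolutelyContinuous hf.contDiffOn
    (absolutelyContinuousOnInterval_congr hac (hwithin n le_rfl).symm)
  rw [taylor_within_apply] at htaylor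
  convert htaylor using 1
  · congr 1
    refine Finset.sum_congr rfl fun i hi => ?_
    rw [hwithin i (by simpa [Nat.lt_succ_iff] using hi) Set.left_mem_uIcc, smul_eq_mul]
    ring
  · refine intervalIntegral.integral_congr_uIoo fun t ht => ?_
    have hnhds : Set.uIcc l x ∈ nhds t := by
      rw [Set.uIoo_of_le hlx] at ht
      rw [Set.uIcc_of_le hlx]
      exact Icc_mem_nhds ht.1 ht.2
    simp only [iteratedDerivWithin_succ, iteratedDeriv_succ, derivWithin_of_mem_nhds hnhds,
      ((hwithin n le_rfl).eventuallyEq_of_mem hnhds).deriv_eq]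

theorem abs_integral_sub_pow_div_factorial_mul_le {g : ℝ → ℝ} {l r x : ℝ}
    (hg : IntervalIntegrable g volume l r) (hx : x ∈ Set.Icc l r) (n : ℕ) :
    |∫ t in l..x, (x - t) ^ n / n.factorial * g t| ≤ (r - l) ^ n * ∫ t in l..r, |g t| := by
  have hlr := hx.1.trans hx.2
  have hgx : IntervalIntegrable g volume l x := hg.mono_set <| by
    rw [Set.uIcc_of_le hx.1, Set.uIcc_of_le hlr]
    exact Set.Icc_subset_Icc_right hx.2
  refine (intervalIntegral.abs_integral_le_integral_abs hx.1).trans ?_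
  rw [← intervalIntegral.integral_const_mul]
  refine (intervalIntegral.integral_mono_on hx.1 ?_ (hgx.abs.const_mul _) fun t ht => ?_).trans
    (intervalIntegral.integral_mono_interval le_rfl hx.1 hx.2
      (Filter.Eventually.of_forall fun t => ?_) (hg.abs.const_mul _))
  · exact (hgx.continuousOn_mul (Continuous.continuousOn (by fun_prop))).abs
  · have hxt : 0 ≤ x - t := sub_nonneg.2 ht.2
    rw [abs_mul, abs_of_nonneg (by positivity)]
    gcongr
    exact (div_le_self (by positivity) (by exact_mod_cast n.factorial_pos)).trans
      (pow_le_pow_left₀ hxt (by linarith [ht.1, hx.2]) n)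
  · have := sub_nonneg.2 hlr
    positivity

theorem exists_degree_lt_sub_sq_le {f : ℝ → ℝ} {n : ℕ} {l r : ℝ} (hlr : l ≤ r)
    (hf : ContDiff ℝ n f) (hac : AbsolutelyContinuousOnInterval (iteratedDeriv n f) l r)
    (hL2 : IntervalIntegrable (fun x => iteratedDeriv (n + 1) f x ^ 2) volume l r) :
    ∃ T : ℝ[X], T.degree < (n + 1 : ℕ) ∧ ∀ x ∈ Set.Icc l r,
      (f x - T.eval x) ^ 2 ≤
        (r - l) ^ (2 * n + 1) * ∫ y in l..r, iteratedDeriv (n + 1) f y ^ 2 := by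
  have hint : IntervalIntegrable (iteratedDeriv (n + 1) f) volume l r := by
    rw [iteratedDeriv_succ]
    exact hac.intervalIntegrable_deriv
  refine ⟨∑ i ∈ Finset.range (n + 1), C (iteratedDeriv i f l / i.factorial) * (X - C l) ^ i, ?_,
    fun x hx => ?_⟩
  · rw [← mem_degreeLT]
    refine Submodule.sum_mem _ fun i hi => mem_degreeLT.2 ?_
    rw [← smul_eq_C_mul]
    exact (degree_smul_le _ _).trans_lt (by
      rw [degree_pow, degree_X_sub_C, nsmul_one]
      exact_mod_cast Finset.mem_range.1 hi)
  have hsub : Set.uIcc l x ⊆ Set.uIcc l r := by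
    rw [Set.uIcc_of_le hx.1, Set.uIcc_of_le hlr]
    exact Set.Icc_subset_Icc_right hx.2
  simp only [eval_finsetSum, eval_mul, eval_C, eval_pow, eval_sub, eval_X]
  rw [sub_sum_iteratedDeriv_eq_integral hx.1 hf (hac.mono hsub)]
  calc (∫ t in l..x, (x - t) ^ n / n.factorial * iteratedDeriv (n + 1) f t) ^ 2
      ≤ ((r - l) ^ n * ∫ t in l..r, |iteratedDeriv (n + 1) f t|) ^ 2 := by
        rw [← sq_abs]
        gcongr
        exact abs_integral_sub_pow_div_factorial_mul_le hint hx n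
    _ = (r - l) ^ (2 * n) * (∫ t in l..r, |iteratedDeriv (n + 1) f t|) ^ 2 := by ring
    _ ≤ (r - l) ^ (2 * n) * ((r - l) * ∫ t in l..r, |iteratedDeriv (n + 1) f t| ^ 2) := by
      have := sub_nonneg.2 hlr
      gcongr
      exact sq_intervalIntegral_le hlr hint.abs (by simpa only [sq_abs] using hL2)
    _ = _ := by simp only [sq_abs]; ring

/-! ### Piecewise polynomials and the `L²` projection -/

namespace Mesh

theorem le {a b : ℝ} {N : ℕ} (M : Mesh a b N) : a ≤ b :=
  M.node_zero.symm.le.trans ((M.strictMono_node.monotone (Fin.zero_le _)).trans M.node_last.le)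

theorem lt {a b : ℝ} {N : ℕ} [NeZero N] (M : Mesh a b N) : a < b :=
  M.node_zero.symm.le.trans_lt ((M.strictMono_node Fin.last_pos').trans_le M.node_last.le)

variable {a b : ℝ} {N k : ℕ} (M : Mesh a b N)

theorem le_left (j : Fin N) : a ≤ M.left j :=
  M.node_zero.symm.le.trans (M.strictMono_node.monotone (Fin.zero_le _))

theorem right_le (j : Fin N) : M.right j ≤ b :=
  (M.strictMono_node.monotone (Fin.le_last _)).trans M.node_last.le

theorem width_pos (j : Fin N) : 0 < M.width j := sub_pos.2 (M.left_lt_right j)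

theorem width_le_size [NeZero N] (j : Fin N) : M.width j ≤ M.size :=
  Finset.le_sup' M.width (Finset.mem_univ j)

theorem size_pos [NeZero N] : 0 < M.size := (M.width_pos 0).trans_le (M.width_le_size 0)

theorem size_le [NeZero N] : M.size ≤ b - a :=
  Finset.sup'_le _ _ fun j _ => sub_le_sub (M.right_le j) (M.le_left j)

theorem uIcc_cell_subset (j : Fin N) : Set.uIcc (M.left j) (M.right j) ⊆ Set.uIcc a b := by
  rw [Set.uIcc_of_le (M.left_lt_right j).le, Set.uIcc_of_le M.le]
  exact Set.Icc_subset_Icc (M.le_left j) (M.right_le j)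

theorem apply_right_eq_apply_left_add_one [NeZero N] {u : ℝ → ℝ} (hu : u a = u b) (j : Fin N) :
    u (M.right j) = u (M.left (j + 1)) := by
  obtain ⟨n, rfl⟩ : ∃ n, N = n + 1 := Nat.exists_eq_succ_of_ne_zero (NeZero.ne N)
  rcases eq_or_ne j (Fin.last n) with rfl | hj
  · rw [show M.right (Fin.last n) = b from M.node_last, Fin.last_add_one,
      show M.left 0 = a from M.node_zero, hu]
  · rw [left, right, show (j + 1).castSucc = j.succ from Fin.ext <| by
      rw [Fin.val_castSucc, Fin.val_succ, Fin.val_add_one_of_lt (Fin.lt_last_iff_ne_last.2 hj)]]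

theorem exists_nodeSeq : ∃ x : ℕ → ℝ, x 0 = a ∧ x N = b ∧
    (∀ j : Fin N, x j = M.left j) ∧ ∀ j : Fin N, x (j + 1) = M.right j := by
  refine ⟨fun i => if h : i < N + 1 then M.node ⟨i, h⟩ else b, ?_, ?_, fun j => ?_, fun j => ?_⟩
  · exact (dif_pos (Nat.succ_pos N)).trans M.node_zero
  · exact (dif_pos (Nat.lt_succ_self N)).trans M.node_last
  · exact dif_pos (j.2.trans (Nat.lt_succ_self N))
  · exact dif_pos (Nat.succ_lt_succ j.2)

theorem intervalIntegrable_of_eqOn_cells {f : ℝ → ℝ} {g : Fin N → ℝ → ℝ}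
    (hg : ∀ j, IntervalIntegrable (g j) volume (M.left j) (M.right j))
    (hfg : ∀ j, Set.EqOn f (g j) (Set.uIoo (M.left j) (M.right j))) :
    IntervalIntegrable f volume a b := by
  obtain ⟨x, h0, hN, hl, hr⟩ := M.exists_nodeSeq
  rw [← h0, ← hN]
  refine IntervalIntegrable.trans_iterate fun i hi => ?_
  simpa only [hl ⟨i, hi⟩, hr ⟨i, hi⟩] using (hg ⟨i, hi⟩).congr_uIoo (hfg ⟨i, hi⟩).symm

theorem sum_integral_cells {f : ℝ → ℝ} (hf : IntervalIntegrable f volume a b) :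
    ∑ j, ∫ x in M.left j..M.right j, f x = ∫ x in a..b, f x := by
  obtain ⟨x, h0, hN, hl, hr⟩ := M.exists_nodeSeq
  have h := intervalIntegral.sum_integral_adjacent_intervals (f := f) (μ := volume) (a := x)
    (n := N) fun i hi => by
      simpa only [← hl, ← hr] using M.intervalIntegrable_cell hf ⟨i, hi⟩
  rw [h0, hN] at h
  rw [← h, ← Fin.sum_univ_eq_sum_range (fun i => ∫ y in x i..x (i + 1), f y) N]
  exact Finset.sum_congr rfl fun j _ => by rw [hl, hr]

theorem integral_eq_sum_of_eqOn_cells {f : ℝ → ℝ} {g : Fin N → ℝ → ℝ}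
    (hg : ∀ j, IntervalIntegrable (g j) volume (M.left j) (M.right j))
    (hfg : ∀ j, Set.EqOn f (g j) (Set.uIoo (M.left j) (M.right j))) :
    ∫ x in a..b, f x = ∑ j, ∫ x in M.left j..M.right j, g j x := by
  rw [← M.sum_integral_cells (M.intervalIntegrable_of_eqOn_cells hg hfg)]
  exact Finset.sum_congr rfl fun j _ => intervalIntegral.integral_congr_uIoo (hfg j)

theorem toFun_eqOn_cell (v : DGSpace N k) (j : Fin N) :
    Set.EqOn (M.toFun v) (fun x => (v j : ℝ[X]).eval x) (Set.uIoo (M.left j) (M.right j)) := by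
  intro x hx
  rw [Set.uIoo_of_le (M.left_lt_right j).le] at hx
  rw [toFun, Finset.sum_eq_single j, Set.indicator_of_mem (Set.Ioo_subset_Ico_self hx)]
  · intro i _ hij
    refine Set.indicator_of_notMem (fun hi => ?_) _
    rcases lt_or_gt_of_ne hij with h | h
    · have : M.right i ≤ M.left j := M.strictMono_node.monotone (Fin.succ_le_castSucc_iff.2 h)
      linarith [hi.2, hx.1]
    · have : M.right j ≤ M.left i := M.strictMono_node.monotone (Fin.succ_le_castSucc_iff.2 h)
      linarith [hi.1, hx.2]
  · simp

theorem intervalIntegrable_toFun (v : DGSpace N k) : IntervalIntegrable (M.toFun v) volume a b :=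
  M.intervalIntegrable_of_eqOn_cells (fun j => (v j : ℝ[X]).continuous.intervalIntegrable _ _)
    (M.toFun_eqOn_cell v)

theorem intervalIntegrable_mul_toFun {f : ℝ → ℝ} (hf : IntervalIntegrable f volume a b)
    (v : DGSpace N k) : IntervalIntegrable (fun x => f x * M.toFun v x) volume a b :=
  M.intervalIntegrable_of_eqOn_cells
    (fun j =>
      (M.intervalIntegrable_cell hf j).mul_continuousOn (v j : ℝ[X]).continuous.continuousOn)
    fun j x hx => by simp only [M.toFun_eqOn_cell v j hx]

theorem integral_toFun (v : DGSpace N k) :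
    ∫ x in a..b, M.toFun v x = ∑ j, ∫ x in M.left j..M.right j, (v j : ℝ[X]).eval x :=
  M.integral_eq_sum_of_eqOn_cells (fun j => (v j : ℝ[X]).continuous.intervalIntegrable _ _)
    (M.toFun_eqOn_cell v)

theorem integral_toFun_sq (v : DGSpace N k) : ∫ x in a..b, M.toFun v x ^ 2 = M.inner v v :=
  M.integral_eq_sum_of_eqOn_cells (fun j => Continuous.intervalIntegrable (by fun_prop) _ _)
    fun j x hx => by simp only [M.toFun_eqOn_cell v j hx, sq]

end Mesh

theorem intervalIntegrable_sub_sq {f g : ℝ → ℝ} {l r : ℝ} (hf : IntervalIntegrable f volume l r)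
    (hf2 : IntervalIntegrable (fun x => f x ^ 2) volume l r) (hg : ContinuousOn g (Set.uIcc l r)) :
    IntervalIntegrable (fun x => (f x - g x) ^ 2) volume l r := by
  simp only [sub_sq, mul_assoc]
  exact (hf2.sub ((hf.mul_continuousOn hg).const_mul 2)).add (hg.pow 2).intervalIntegrable

namespace Mesh

variable {a b : ℝ} {N k : ℕ} (M : Mesh a b N)

theorem inner_self_nonneg (v : DGSpace N k) : 0 ≤ M.inner v v :=
  M.integral_toFun_sq v ▸ intervalIntegral.integral_nonneg M.le fun _ _ => sq_nonneg _

theorem inner_comm (v w : DGSpace N k) : M.inner v w = M.inner w v := by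
  simp only [inner_apply, mul_comm]

theorem inner_add_self_le (v w : DGSpace N k) :
    M.inner (v + w) (v + w) ≤ 2 * M.inner v v + 2 * M.inner w w := by
  have h := M.inner_self_nonneg (v - w)
  simp only [map_add, map_sub, LinearMap.add_apply, LinearMap.sub_apply] at h ⊢
  linarith

theorem ext_inner {v w : DGSpace N k} (h : ∀ z, M.inner v z = M.inner w z) : v = w :=
  sub_eq_zero.1 <| M.inner_self_eq_zero <| by rw [LinearMap.map_sub₂, h, sub_self]

theorem inner_proj₀ {f : ℝ → ℝ} (hf : IntervalIntegrable f volume a b) (v : DGSpace N k) :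
    M.inner (M.proj₀ k f) v = ∑ j, ∫ x in M.left j..M.right j, f x * (v j : ℝ[X]).eval x := by
  rw [proj₀, dif_pos hf]
  exact LinearMap.BilinForm.apply_toDual_symm_apply (hB := M.inner_nondegenerate) _ _

theorem inner_proj₀_eq_integral {f : ℝ → ℝ} (hf : IntervalIntegrable f volume a b)
    (v : DGSpace N k) : M.inner (M.proj₀ k f) v = ∫ x in a..b, f x * M.toFun v x := by
  rw [M.inner_proj₀ hf]
  exact (M.integral_eq_sum_of_eqOn_cells (fun j => (M.intervalIntegrable_cell hf j).mul_continuousOn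
    (v j : ℝ[X]).continuous.continuousOn) fun j x hx => by
      simp only [M.toFun_eqOn_cell v j hx]).symm

theorem integral_proj₀_mul {f : ℝ → ℝ} (hf : IntervalIntegrable f volume a b) (j : Fin N)
    {p : ℝ[X]} (hp : p.degree < (k + 1 : ℕ)) :
    ∫ x in M.left j..M.right j, (M.proj₀ k f j : ℝ[X]).eval x * p.eval x =
      ∫ x in M.left j..M.right j, f x * p.eval x := by
  have h := M.inner_proj₀ hf (Pi.single j (⟨p, mem_degreeLT.2 hp⟩ : degreeLT ℝ (k + 1)))
  rw [inner_apply, Finset.sum_eq_single j, Finset.sum_eq_single j] at h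
  · simpa using h
  all_goals simp +contextual [Pi.single_eq_of_ne]

theorem proj₀_eq_of_eqOn_cells {f : ℝ → ℝ} {v : DGSpace N k}
    (h : ∀ j, Set.EqOn f (fun x => (v j : ℝ[X]).eval x) (Set.uIoo (M.left j) (M.right j))) :
    M.proj₀ k f = v := by
  refine M.ext_inner fun z => ?_
  rw [M.inner_proj₀ (M.intervalIntegrable_of_eqOn_cells
    (fun j => (v j : ℝ[X]).continuous.intervalIntegrable _ _) h), inner_apply]
  exact Finset.sum_congr rfl fun j _ =>
    intervalIntegral.integral_congr_uIoo fun x hx => by simp only [h j hx]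

theorem proj₀_toFun (v : DGSpace N k) : M.proj₀ k (M.toFun v) = v :=
  M.proj₀_eq_of_eqOn_cells (M.toFun_eqOn_cell v)

theorem proj₀_const_mul {f : ℝ → ℝ} (hf : IntervalIntegrable f volume a b) (c : ℝ) :
    M.proj₀ k (fun x => c * f x) = c • M.proj₀ k f :=
  M.ext_inner fun z => by
    rw [map_smul, LinearMap.smul_apply, smul_eq_mul, M.inner_proj₀_eq_integral hf,
      M.inner_proj₀_eq_integral (hf.const_mul c), ← intervalIntegral.integral_const_mul]
    simp only [mul_assoc]

theorem integral_sub_proj₀_mul_toFun {f : ℝ → ℝ} (hf : IntervalIntegrable f volume a b)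
    (v : DGSpace N k) :
    ∫ x in a..b, (f x - M.toFun (M.proj₀ k f) x) * M.toFun v x = 0 := by
  simp only [sub_mul]
  rw [intervalIntegral.integral_sub (M.intervalIntegrable_mul_toFun hf v)
      (M.intervalIntegrable_mul_toFun (M.intervalIntegrable_toFun _) v),
    ← M.inner_proj₀_eq_integral hf, ← M.inner_proj₀_eq_integral (M.intervalIntegrable_toFun _),
    proj₀_toFun, sub_self]

section Pythagoras

variable {f : ℝ → ℝ} (hf : IntervalIntegrable f volume a b)
  (hf2 : IntervalIntegrable (fun x => f x ^ 2) volume a b)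

include hf hf2

theorem intervalIntegrable_sub_sq_cell (j : Fin N) (p : ℝ[X]) :
    IntervalIntegrable (fun x => (f x - p.eval x) ^ 2) volume (M.left j) (M.right j) :=
  intervalIntegrable_sub_sq (M.intervalIntegrable_cell hf j) (M.intervalIntegrable_cell hf2 j)
    (Polynomial.continuous _).continuousOn

theorem integral_sq_sub_eval_eq_add (j : Fin N) {p : ℝ[X]} (hp : p.degree < (k + 1 : ℕ)) :
    ∫ x in M.left j..M.right j, (f x - p.eval x) ^ 2 =
      (∫ x in M.left j..M.right j, (f x - (M.proj₀ k f j : ℝ[X]).eval x) ^ 2) +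
        ∫ x in M.left j..M.right j, (p - (M.proj₀ k f j : ℝ[X])).eval x ^ 2 := by
  set P : ℝ[X] := (M.proj₀ k f j : ℝ[X])
  set d := p - P with hd
  have horth := M.integral_proj₀_mul hf j (p := d)
    ((degree_sub_le _ _).trans_lt (max_lt hp (mem_degreeLT.1 (M.proj₀ k f j).2)))
  have hfd := (M.intervalIntegrable_cell hf j).mul_continuousOn d.continuous.continuousOn
  have hPd : IntervalIntegrable (fun x => P.eval x * d.eval x) volume (M.left j) (M.right j) :=
    Continuous.intervalIntegrable (by fun_prop) _ _
  have hdd : IntervalIntegrable (fun x => d.eval x ^ 2) volume (M.left j) (M.right j) :=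
    Continuous.intervalIntegrable (by fun_prop) _ _
  have hsq := M.intervalIntegrable_sub_sq_cell hf hf2 j P
  calc ∫ x in M.left j..M.right j, (f x - p.eval x) ^ 2
      = ∫ x in M.left j..M.right j, ((f x - P.eval x) ^ 2 + d.eval x ^ 2 -
          2 * (f x * d.eval x - P.eval x * d.eval x)) := by
        congr 1 with x; rw [hd, eval_sub]; ring
    _ = _ := by
        rw [intervalIntegral.integral_sub (hsq.add hdd) ((hfd.sub hPd).const_mul 2),
          intervalIntegral.integral_add hsq hdd, intervalIntegral.integral_const_mul,
          intervalIntegral.integral_sub hfd hPd, ← horth, sub_self, mul_zero, sub_zero]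

theorem integral_sq_sub_toFun (v : DGSpace N k) :
    ∫ x in a..b, (f x - M.toFun v x) ^ 2 =
      ∑ j, ∫ x in M.left j..M.right j, (f x - (v j : ℝ[X]).eval x) ^ 2 :=
  M.integral_eq_sum_of_eqOn_cells (fun j => M.intervalIntegrable_sub_sq_cell hf hf2 j _)
    fun j x hx => by simp only [M.toFun_eqOn_cell v j hx]

theorem integral_sq_sub_toFun_eq_add (v : DGSpace N k) :
    ∫ x in a..b, (f x - M.toFun v x) ^ 2 =
      (∫ x in a..b, (f x - M.toFun (M.proj₀ k f) x) ^ 2) +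
        M.inner (v - M.proj₀ k f) (v - M.proj₀ k f) := by
  rw [M.integral_sq_sub_toFun hf hf2, M.integral_sq_sub_toFun hf hf2, inner_apply,
    ← Finset.sum_add_distrib]
  refine Finset.sum_congr rfl fun j _ => ?_
  rw [M.integral_sq_sub_eval_eq_add hf hf2 j (mem_degreeLT.1 (v j).2)]
  simp only [Pi.sub_apply, AddSubgroupClass.coe_sub, sq]

theorem inner_proj₀_self_le : M.inner (M.proj₀ k f) (M.proj₀ k f) ≤ ∫ x in a..b, f x ^ 2 := by
  have h := M.integral_sq_sub_toFun_eq_add hf hf2 (0 : DGSpace N k)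
  have h0 : 0 ≤ ∫ x in a..b, (f x - M.toFun (M.proj₀ k f) x) ^ 2 :=
    intervalIntegral.integral_nonneg M.le fun _ _ => sq_nonneg _
  simp only [toFun, Pi.zero_apply, ZeroMemClass.coe_zero, eval_zero, Set.indicator_zero,
    Finset.sum_const_zero, sub_zero, zero_sub, map_neg, LinearMap.neg_apply, neg_neg] at h h0
  linarith

end Pythagoras

/-- On each cell `I_j` the function `u` is within squared distance `d j`, uniformly, of a polynomial
of degree at most `k`. This is the form in which the approximation power of `V_h` is used. -/
def ApproxOnCells (k : ℕ) (u : ℝ → ℝ) (d : Fin N → ℝ) : Prop :=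
  ∀ j, ∃ T : ℝ[X], T.degree < (k + 1 : ℕ) ∧
    ∀ x ∈ Set.Icc (M.left j) (M.right j), (u x - T.eval x) ^ 2 ≤ d j

namespace ApproxOnCells

variable {M} {u : ℝ → ℝ} {d : Fin N → ℝ} (hd : M.ApproxOnCells k u d)

include hd

theorem nonneg (j : Fin N) : 0 ≤ d j :=
  let ⟨_, _, hT⟩ := hd j
  (sq_nonneg _).trans (hT _ (Set.left_mem_Icc.2 (M.left_lt_right j).le))

variable (hu : IntervalIntegrable u volume a b)
  (hu2 : IntervalIntegrable (fun x => u x ^ 2) volume a b)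

include hu hu2

theorem exists_integral_sq_add_le (j : Fin N) : ∃ T : ℝ[X], T.degree < (k + 1 : ℕ) ∧
    (∀ x ∈ Set.Icc (M.left j) (M.right j), (u x - T.eval x) ^ 2 ≤ d j) ∧
    (∫ x in M.left j..M.right j, (u x - (M.proj₀ k u j : ℝ[X]).eval x) ^ 2) +
      ∫ x in M.left j..M.right j, (T - (M.proj₀ k u j : ℝ[X])).eval x ^ 2 ≤ M.width j * d j := by
  obtain ⟨T, hdeg, hT⟩ := hd j
  refine ⟨T, hdeg, hT, ?_⟩
  rw [← M.integral_sq_sub_eval_eq_add hu hu2 j hdeg]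
  calc ∫ x in M.left j..M.right j, (u x - T.eval x) ^ 2
      ≤ ∫ _ in M.left j..M.right j, d j :=
        intervalIntegral.integral_mono_on (M.left_lt_right j).le
          (M.intervalIntegrable_sub_sq_cell hu hu2 j T) intervalIntegrable_const hT
    _ = M.width j * d j := by rw [intervalIntegral.integral_const, smul_eq_mul, width]

theorem integral_sub_proj₀_sq_le [NeZero N] :
    ∫ x in a..b, (u x - M.toFun (M.proj₀ k u) x) ^ 2 ≤ M.size * ∑ j, d j := by
  rw [M.integral_sq_sub_toFun hu hu2, Finset.mul_sum]
  refine Finset.sum_le_sum fun j _ => ?_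
  obtain ⟨T, -, -, hT⟩ := hd.exists_integral_sq_add_le hu hu2 j
  have hpos : 0 ≤ ∫ x in M.left j..M.right j, (T - (M.proj₀ k u j : ℝ[X])).eval x ^ 2 :=
    intervalIntegral.integral_nonneg (M.left_lt_right j).le fun _ _ => sq_nonneg _
  have hw := mul_le_mul_of_nonneg_right (M.width_le_size j) (hd.nonneg j)
  linarith

theorem sub_proj₀_sq_endpoint_le (j : Fin N) {x : ℝ} (hx : x = M.left j ∨ x = M.right j) :
    (u x - (M.proj₀ k u j : ℝ[X]).eval x) ^ 2 ≤ 2 * (1 + (k + 1) ^ 2) * d j := by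
  obtain ⟨T, hdeg, hTx, hT⟩ := hd.exists_integral_sq_add_le hu hu2 j
  set P : ℝ[X] := (M.proj₀ k u j : ℝ[X])
  have hlr := M.left_lt_right j
  have hpos : 0 ≤ ∫ x in M.left j..M.right j, (u x - P.eval x) ^ 2 :=
    intervalIntegral.integral_nonneg hlr.le fun _ _ => sq_nonneg _
  have hinv := sub_mul_sq_eval_endpoint_le (q := T - P)
    ((degree_sub_le _ _).trans_lt (max_lt hdeg (mem_degreeLT.1 (M.proj₀ k u j).2))) hlr hx
  have hTP : (T - P).eval x ^ 2 ≤ (k + 1) ^ 2 * d j := by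
    refine le_of_mul_le_mul_left (hinv.trans ?_) (sub_pos.2 hlr)
    calc ((k + 1 : ℕ) : ℝ) ^ 2 * ∫ y in M.left j..M.right j, (T - P).eval y ^ 2
        ≤ ((k + 1 : ℕ) : ℝ) ^ 2 * (M.width j * d j) := by gcongr; linarith
      _ = (M.right j - M.left j) * ((k + 1) ^ 2 * d j) := by rw [width]; push_cast; ring
  have hux : (u x - T.eval x) ^ 2 ≤ d j :=
    hTx x (by rcases hx with rfl | rfl <;> simp only [Set.mem_Icc, le_refl, hlr.le, and_self])
  calc (u x - P.eval x) ^ 2 = ((u x - T.eval x) + (T - P).eval x) ^ 2 := by rw [eval_sub]; ring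
    _ ≤ 2 * ((u x - T.eval x) ^ 2 + (T - P).eval x ^ 2) := add_sq_le
    _ ≤ 2 * (1 + (k + 1) ^ 2) * d j := by linarith

end ApproxOnCells

theorem inner_const (v : DGSpace N k) (c : ℝ) :
    M.inner v (const N k c) = c * ∑ j, ∫ x in M.left j..M.right j, (v j : ℝ[X]).eval x := by
  rw [inner_apply, Finset.mul_sum]
  refine Finset.sum_congr rfl fun j _ => ?_
  simp only [const, eval_C, intervalIntegral.integral_mul_const, mul_comm c]

theorem mem_zeroMean_iff {v : DGSpace N k} : v ∈ M.zeroMean ↔ M.inner v (const N k 1) = 0 := by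
  rw [inner_const, one_mul]; rfl

theorem inner_const_one_self : M.inner (const N k 1) (const N k 1) = b - a := by
  rw [inner_const, one_mul, ← M.integral_eq_sum_of_eqOn_cells (f := fun _ => 1)
    (fun j => ((const N k 1 j : ℝ[X]).continuous.intervalIntegrable _ _)) fun j _ _ => eval_C.symm,
    intervalIntegral.integral_const, smul_eq_mul, mul_one]

theorem inner_proj₀_const_one {f : ℝ → ℝ} (hf : IntervalIntegrable f volume a b) :
    M.inner (M.proj₀ k f) (const N k 1) = ∫ x in a..b, f x := by
  rw [M.inner_proj₀ hf, ← M.sum_integral_cells hf]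
  simp only [const, eval_C, mul_one]

theorem proj₀_mem_zeroMean {f : ℝ → ℝ} (hf : IntervalIntegrable f volume a b)
    (h0 : ∫ x in a..b, f x = 0) : M.proj₀ k f ∈ M.zeroMean :=
  M.mem_zeroMean_iff.2 ((M.inner_proj₀_const_one hf).trans h0)

/-- The `L²` projection of `V_h` onto `Z_h`, which subtracts the mean value. -/
def zeroMeanProj : DGSpace N k →ₗ[ℝ] DGSpace N k :=
  LinearMap.id - (b - a)⁻¹ • (M.inner.flip (const N k 1)).smulRight (const N k 1)

theorem const_eq_smul (c : ℝ) : const N k c = c • const N k 1 :=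
  funext fun j => Subtype.ext <| by simp [const, smul_eq_C_mul]

theorem zeroMeanProj_apply (v : DGSpace N k) :
    M.zeroMeanProj v = v - const N k (M.inner v (const N k 1) / (b - a)) := by
  rw [const_eq_smul, div_eq_inv_mul, mul_smul]; rfl

theorem zeroMeanProj_of_mem {v : DGSpace N k} (hv : v ∈ M.zeroMean) : M.zeroMeanProj v = v := by
  rw [zeroMeanProj_apply, M.mem_zeroMean_iff.1 hv, zero_div, const_eq_smul, zero_smul, sub_zero]

theorem zeroMeanProj_mem [NeZero N] (v : DGSpace N k) : M.zeroMeanProj v ∈ M.zeroMean := by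
  have hab := (sub_pos.2 M.lt).ne'
  rw [mem_zeroMean_iff, zeroMeanProj_apply, const_eq_smul, LinearMap.map_sub₂, LinearMap.map_smul₂,
    inner_const_one_self, smul_eq_mul, div_mul_cancel₀ _ hab, sub_self]

theorem inner_zeroMeanProj_self_le [NeZero N] (v : DGSpace N k) :
    M.inner (M.zeroMeanProj v) (M.zeroMeanProj v) ≤ M.inner v v := by
  obtain ⟨c, hc⟩ : ∃ c : ℝ, v = M.zeroMeanProj v + c • const N k 1 :=
    ⟨_, by rw [zeroMeanProj_apply, ← const_eq_smul, sub_add_cancel]⟩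
  have horth := M.mem_zeroMean_iff.1 (M.zeroMeanProj_mem v)
  have hnonneg := M.inner_self_nonneg (c • const N k 1)
  set z := M.zeroMeanProj v
  rw [hc]
  simp only [map_add, LinearMap.add_apply, map_smul, LinearMap.smul_apply, smul_eq_mul, horth,
    M.inner_comm _ z, mul_zero, add_zero, zero_add] at hnonneg ⊢
  linarith

theorem zeroMeanProj_proj₀ {f : ℝ → ℝ} (hf : IntervalIntegrable f volume a b) :
    M.zeroMeanProj (M.proj₀ k f) =
      M.proj₀ k f - const N k ((∫ x in a..b, f x) / ∫ _ in a..b, (1 : ℝ)) := by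
  rw [zeroMeanProj_apply, M.inner_proj₀_const_one hf, intervalIntegral.integral_const,
    smul_eq_mul, mul_one]

end Mesh

/-! ### Generalized Gauss-Radau projections -/

section Circulant

variable {N : ℕ} [NeZero N]

theorem sum_comp_add_one (f : Fin N → ℝ) : ∑ j, f (j + 1) = ∑ j, f j :=
  Equiv.sum_comp (Equiv.addRight (1 : Fin N)) f

theorem mul_sum_sq_le_sum_circulant_sq (s t : ℝ) (c : Fin N → ℝ) :
    (|s| - |t|) ^ 2 * ∑ j, c j ^ 2 ≤ ∑ j, (s * c j + t * c (j + 1)) ^ 2 := by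
  have h : ∀ j, s ^ 2 * c j ^ 2 + t ^ 2 * c (j + 1) ^ 2 - |s| * |t| * (c j ^ 2 + c (j + 1) ^ 2) ≤
      (s * c j + t * c (j + 1)) ^ 2 := fun j => by
    have habs : -(|s| * |t| * (|c j| * |c (j + 1)|)) ≤ s * t * (c j * c (j + 1)) := by
      rw [← abs_mul, ← abs_mul, ← abs_mul]; exact neg_abs_le _
    have hamgm : 2 * (|c j| * |c (j + 1)|) ≤ c j ^ 2 + c (j + 1) ^ 2 := by
      simpa only [sq_abs, mul_assoc] using two_mul_le_add_sq |c j| |c (j + 1)|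
    nlinarith [mul_le_mul_of_nonneg_left hamgm (mul_nonneg (abs_nonneg s) (abs_nonneg t))]
  refine le_trans (le_of_eq ?_) (Finset.sum_le_sum fun j _ => h j)
  rw [Finset.sum_sub_distrib, Finset.sum_add_distrib, ← Finset.mul_sum, ← Finset.mul_sum,
    ← Finset.mul_sum, Finset.sum_add_distrib, sum_comp_add_one (fun j => c j ^ 2), sub_sq, sq_abs,
    sq_abs]
  ring

theorem exists_circulant_solution {s t : ℝ} (hst : |s| ≠ |t|) (g : Fin N → ℝ) :
    ∃ c : Fin N → ℝ, (∀ j, s * c j + t * c (j + 1) = g j) ∧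
      (|s| - |t|) ^ 2 * ∑ j, c j ^ 2 ≤ ∑ j, g j ^ 2 := by
  let A : (Fin N → ℝ) →ₗ[ℝ] (Fin N → ℝ) := s • LinearMap.id + t • LinearMap.funLeft ℝ ℝ (· + 1)
  have hinj : Function.Injective A := by
    refine (injective_iff_map_eq_zero A).2 fun c hc => funext fun j => ?_
    have hle := mul_sum_sq_le_sum_circulant_sq s t c
    simp only [show ∀ j, s * c j + t * c (j + 1) = 0 from fun j => congrFun hc j, ne_eq,
      OfNat.ofNat_ne_zero, not_false_eq_true, zero_pow, Finset.sum_const_zero] at hle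
    have hsum : ∑ j, c j ^ 2 ≤ 0 :=
      nonpos_of_mul_nonpos_right hle (sq_pos_of_ne_zero (sub_ne_zero.2 hst))
    exact pow_eq_zero_iff two_ne_zero |>.1 <| le_antisymm
      ((Finset.single_le_sum (fun i _ => sq_nonneg (c i)) (Finset.mem_univ j)).trans hsum)
      (sq_nonneg _)
  obtain ⟨c, hc⟩ := LinearMap.injective_iff_surjective.1 hinj g
  have hcg : ∀ j, s * c j + t * c (j + 1) = g j := fun j => congrFun hc j
  exact ⟨c, hcg, by simpa only [hcg] using mul_sum_sq_le_sum_circulant_sq s t c⟩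

end Circulant

theorem abs_ne_abs_one_sub {t : ℝ} (ht : t ≠ 1 / 2) : |t| ≠ |1 - t| := by
  rw [Ne, abs_eq_abs]
  rintro (h | h)
  · exact ht (by linarith)
  · linarith

/-- The constant in the estimate of the distance between the generalized Gauss-Radau projection with
parameter `t` and the `L²` projection. The denominator is the square of the smallest singular value
bound of the circulant system for the top Legendre coefficients. -/
def gaussRadauConst (k : ℕ) (t : ℝ) : ℝ :=
  4 * (1 + (k + 1) ^ 2) * (t ^ 2 + (1 - t) ^ 2) / (|t| - |1 - t|) ^ 2

theorem gaussRadauConst_nonneg (k : ℕ) (t : ℝ) : 0 ≤ gaussRadauConst k t := by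
  unfold gaussRadauConst; positivity

namespace Mesh

variable {a b : ℝ} {N k : ℕ} (M : Mesh a b N)

/-- The element of `V_h` which is `c j` times the Legendre polynomial of degree `k` on each cell
`I_j`. -/
def legendreCombination (k : ℕ) (c : Fin N → ℝ) : DGSpace N k := fun j =>
  c j • ⟨legendre k (M.left j) (M.right j), mem_degreeLT.2 (degree_legendre_lt k _ _)⟩

theorem coe_legendreCombination (c : Fin N → ℝ) (j : Fin N) :
    (M.legendreCombination k c j : ℝ[X]) = c j • legendre k (M.left j) (M.right j) := rfl

variable [NeZero N]

/-- `p` is a generalized Gauss-Radau projection of the periodic function `u`: it has the moments of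
`u` against polynomials of degree less than `k` on each cell, and its numerical flux with parameter
`t` is the value of `u` at each node. -/
structure IsGaussRadau (t : ℝ) (u : ℝ → ℝ) (p : DGSpace N k) : Prop where
  integral_mul_eq : ∀ (j : Fin N) (v : ℝ[X]), v.degree < k →
    ∫ x in M.left j..M.right j, (p j : ℝ[X]).eval x * v.eval x =
      ∫ x in M.left j..M.right j, u x * v.eval x
  flux_eq : ∀ j, M.flux t j p = u (M.right j)

theorem flux_add (t : ℝ) (j : Fin N) (v w : DGSpace N k) :
    M.flux t j (v + w) = M.flux t j v + M.flux t j w := by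
  simp only [flux, traceMinus, tracePlus, Pi.add_apply, Submodule.coe_add, eval_add]; ring

theorem flux_legendreCombination (t : ℝ) (c : Fin N → ℝ) (j : Fin N) :
    M.flux t j (M.legendreCombination k c) = t * c j + (1 - t) * (-1) ^ k * c (j + 1) := by
  simp only [flux, traceMinus, tracePlus, coe_legendreCombination, eval_smul, smul_eq_mul,
    legendre_eval_right k (M.left_lt_right _), legendre_eval_left k (M.left_lt_right _)]
  ring

theorem inner_legendreCombination_self_le (c : Fin N → ℝ) :
    M.inner (M.legendreCombination k c) (M.legendreCombination k c) ≤ M.size * ∑ j, c j ^ 2 := by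
  rw [inner_apply, Finset.mul_sum]
  refine Finset.sum_le_sum fun j _ => ?_
  calc ∫ x in M.left j..M.right j, (M.legendreCombination k c j : ℝ[X]).eval x *
        (M.legendreCombination k c j : ℝ[X]).eval x
      = c j ^ 2 * (M.width j / (2 * k + 1)) := by
        rw [width, ← integral_legendre_mul_self k (M.left_lt_right j),
          ← intervalIntegral.integral_const_mul]
        congr 1 with x
        rw [coe_legendreCombination, eval_smul, smul_eq_mul]; ring
    _ ≤ c j ^ 2 * M.size := by
        gcongr
        exact (div_le_self (M.width_pos j).le (by linarith [k.cast_nonneg (α := ℝ)])).trans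
          (M.width_le_size j)
    _ = M.size * c j ^ 2 := mul_comm _ _

variable {M} in
theorem ApproxOnCells.sum_sub_flux_proj₀_sq_le {u : ℝ → ℝ} {d : Fin N → ℝ}
    (hd : M.ApproxOnCells k u d) (hu : IntervalIntegrable u volume a b)
    (hu2 : IntervalIntegrable (fun x => u x ^ 2) volume a b) (hper : u a = u b) (t : ℝ) :
    ∑ j, (u (M.right j) - M.flux t j (M.proj₀ k u)) ^ 2 ≤
      4 * (1 + (k + 1) ^ 2) * (t ^ 2 + (1 - t) ^ 2) * ∑ j, d j := by
  have hj : ∀ j, (u (M.right j) - M.flux t j (M.proj₀ k u)) ^ 2 ≤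
      4 * (1 + (k + 1) ^ 2) * (t ^ 2 * d j + (1 - t) ^ 2 * d (j + 1)) := fun j => by
    have hr := hd.sub_proj₀_sq_endpoint_le hu hu2 j (.inr rfl)
    have hl := hd.sub_proj₀_sq_endpoint_le hu hu2 (j + 1) (.inl rfl)
    rw [← M.apply_right_eq_apply_left_add_one hper j] at hl
    set A := u (M.right j) - M.traceMinus j (M.proj₀ k u) with hA
    set B := u (M.right j) - M.tracePlus j (M.proj₀ k u) with hB
    calc (u (M.right j) - M.flux t j (M.proj₀ k u)) ^ 2
        = (t * A + (1 - t) * B) ^ 2 := by rw [hA, hB, flux]; ring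
      _ ≤ 2 * ((t * A) ^ 2 + ((1 - t) * B) ^ 2) := add_sq_le
      _ = 2 * (t ^ 2 * A ^ 2 + (1 - t) ^ 2 * B ^ 2) := by ring
      _ ≤ 2 * (t ^ 2 * (2 * (1 + (k + 1) ^ 2) * d j) +
            (1 - t) ^ 2 * (2 * (1 + (k + 1) ^ 2) * d (j + 1))) := by gcongr <;> assumption
      _ = 4 * (1 + (k + 1) ^ 2) * (t ^ 2 * d j + (1 - t) ^ 2 * d (j + 1)) := by ring
  refine (Finset.sum_le_sum fun j _ => hj j).trans_eq ?_
  rw [← Finset.mul_sum, Finset.sum_add_distrib, ← Finset.mul_sum, ← Finset.mul_sum,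
    sum_comp_add_one d]
  ring

variable {M} in
theorem ApproxOnCells.exists_isGaussRadau {u : ℝ → ℝ} {d : Fin N → ℝ}
    (hd : M.ApproxOnCells k u d) (hu : IntervalIntegrable u volume a b)
    (hu2 : IntervalIntegrable (fun x => u x ^ 2) volume a b) (hper : u a = u b) {t : ℝ}
    (ht : t ≠ 1 / 2) : ∃ p : DGSpace N k, M.IsGaussRadau t u p ∧
      M.inner (p - M.proj₀ k u) (p - M.proj₀ k u) ≤ gaussRadauConst k t * M.size * ∑ j, d j := by
  have habs : |(1 - t) * (-1) ^ k| = |1 - t| := by rw [abs_mul, abs_neg_one_pow, mul_one]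
  obtain ⟨c, hc, hcle⟩ := exists_circulant_solution (s := t) (t := (1 - t) * (-1) ^ k)
    (habs ▸ abs_ne_abs_one_sub ht) fun j => u (M.right j) - M.flux t j (M.proj₀ k u)
  refine ⟨M.proj₀ k u + M.legendreCombination k c, ⟨fun j v hv => ?_, fun j => ?_⟩, ?_⟩
  · rw [← M.integral_proj₀_mul hu j (hv.trans (Nat.cast_lt.2 k.lt_succ_self)), ← sub_eq_zero,
      ← intervalIntegral.integral_sub (Continuous.intervalIntegrable (by fun_prop) _ _)
        (Continuous.intervalIntegrable (by fun_prop) _ _)]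
    simp only [Pi.add_apply, Submodule.coe_add, coe_legendreCombination, eval_add, eval_smul,
      smul_eq_mul, add_mul, add_sub_cancel_left, mul_assoc, mul_comm (eval _ (legendre k _ _)),
      intervalIntegral.integral_const_mul, integral_eval_mul_legendre_eq_zero hv, mul_zero]
  · rw [flux_add, flux_legendreCombination, hc, add_sub_cancel]
  · rw [add_sub_cancel_left]
    refine (M.inner_legendreCombination_self_le c).trans ?_
    rw [gaussRadauConst, mul_right_comm, mul_comm M.size, div_mul_eq_mul_div]
    gcongr
    · exact M.size_pos.le
    rw [le_div_iff₀' (by have := sub_ne_zero.2 (abs_ne_abs_one_sub ht); positivity), ← habs]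
    exact hcle.trans (hd.sum_sub_flux_proj₀_sq_le hu hu2 hper t)

end Mesh

/-! ### The operators `D_{h,θ}` and their inverses -/

namespace Mesh

variable {a b : ℝ} {N k : ℕ} (M : Mesh a b N) [NeZero N]

theorem dgForm_apply (t : ℝ) (w v : DGSpace N k) : M.dgForm t w v =
    -(∑ j, ∫ x in M.left j..M.right j, (w j : ℝ[X]).eval x * (derivative (v j : ℝ[X])).eval x)
      - ∑ j, M.flux t j w * M.jump j v := rfl

variable {M} in
theorem IsGaussRadau.D_eq {t : ℝ} {u : ℝ → ℝ} {p : DGSpace N k} (hp : M.IsGaussRadau t u p)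
    (hu : AbsolutelyContinuousOnInterval u a b) (hper : u a = u b) :
    M.D k t p = M.proj₀ k (deriv u) := by
  refine M.ext_inner fun v => ?_
  rw [inner_D, M.inner_proj₀ hu.intervalIntegrable_deriv, dgForm_apply]
  have hibp : ∀ j, ∫ x in M.left j..M.right j,
      (p j : ℝ[X]).eval x * (derivative (v j : ℝ[X])).eval x =
      u (M.right j) * (v j : ℝ[X]).eval (M.right j) - u (M.left j) * (v j : ℝ[X]).eval (M.left j) -
        ∫ x in M.left j..M.right j, deriv u x * (v j : ℝ[X]).eval x := fun j => by
    have hv : AbsolutelyContinuousOnInterval (fun x => (v j : ℝ[X]).eval x) (M.left j)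
        (M.right j) :=
      ((v j : ℝ[X]).contDiff_aeval (R := ℝ) (𝕜 := ℝ) 1).contDiffOn.absolutelyContinuousOnInterval
    rw [hp.integral_mul_eq j _ (degree_derivative_lt_of_lt_succ (mem_degreeLT.1 (v j).2))]
    simpa only [Polynomial.deriv] using
      (hu.mono (M.uIcc_cell_subset j)).integral_mul_deriv_eq_deriv_mul hv
  have hshift : ∑ j, u (M.right j) * (v (j + 1) : ℝ[X]).eval (M.left (j + 1)) =
      ∑ j, u (M.left j) * (v j : ℝ[X]).eval (M.left j) := by
    rw [← sum_comp_add_one fun j => u (M.left j) * (v j : ℝ[X]).eval (M.left j)]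
    exact Finset.sum_congr rfl fun j _ => by rw [M.apply_right_eq_apply_left_add_one hper j]
  simp only [hibp, hp.flux_eq, jump, tracePlus, traceMinus, mul_sub, Finset.sum_sub_distrib, hshift]
  ring

theorem D_mem_zeroMean (t : ℝ) (w : DGSpace N k) : M.D k t w ∈ M.zeroMean := by
  simp only [mem_zeroMean_iff, inner_D, dgForm_apply, const, derivative_C, eval_zero, mul_zero,
    intervalIntegral.integral_zero, Finset.sum_const_zero, neg_zero, jump, tracePlus, traceMinus,
    eval_C, sub_self]

theorem inner_D_left (t : ℝ) (w v : DGSpace N k) :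
    M.inner (M.D k t w) v = -M.inner w (M.D k (1 - t) v) := by
  rw [M.inner_comm w, inner_D, inner_D, dgForm_apply, dgForm_apply]
  have hibp : ∀ j, ∫ x in M.left j..M.right j,
      (w j : ℝ[X]).eval x * (derivative (v j : ℝ[X])).eval x =
      M.traceMinus j w * M.traceMinus j v -
        (w j : ℝ[X]).eval (M.left j) * (v j : ℝ[X]).eval (M.left j) -
        ∫ x in M.left j..M.right j, (v j : ℝ[X]).eval x * (derivative (w j : ℝ[X])).eval x :=
    fun j => by
      simp only [mul_comm ((v j : ℝ[X]).eval _)]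
      exact integral_eval_mul_derivative _ _ _ _
  have hshift : ∑ j, (w j : ℝ[X]).eval (M.left j) * (v j : ℝ[X]).eval (M.left j) =
      ∑ j, M.tracePlus j w * M.tracePlus j v :=
    (sum_comp_add_one fun j => (w j : ℝ[X]).eval (M.left j) * (v j : ℝ[X]).eval (M.left j)).symm
  have hflux : ∑ j, M.flux t j w * M.jump j v + ∑ j, M.flux (1 - t) j v * M.jump j w =
      ∑ j, M.tracePlus j w * M.tracePlus j v - ∑ j, M.traceMinus j w * M.traceMinus j v := by
    rw [← Finset.sum_add_distrib, ← Finset.sum_sub_distrib]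
    refine Finset.sum_congr rfl fun j _ => ?_
    simp only [flux, jump]; ring
  simp only [hibp, Finset.sum_sub_distrib, hshift]
  linarith

theorem D_const (t c : ℝ) : M.D k t (const N k c) = 0 :=
  M.ext_inner fun v => by
    rw [inner_D_left, M.inner_comm, const_eq_smul, map_smul,
      M.mem_zeroMean_iff.1 (M.D_mem_zeroMean _ v), smul_zero, neg_zero, LinearMap.map_zero₂]

theorem D_zeroMeanProj (t : ℝ) (v : DGSpace N k) : M.D k t (M.zeroMeanProj v) = M.D k t v := by
  rw [zeroMeanProj_apply, map_sub, D_const, sub_zero]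

end Mesh

/-- The squared operator norm bound for `D_{h,θ}⁻¹ : Z_h → Z_h`, uniform in the mesh. -/
def stabilityConst (k : ℕ) (t a b : ℝ) : ℝ := 2 * (gaussRadauConst k t + 1) * (b - a) ^ 2

theorem stabilityConst_nonneg (k : ℕ) (t a b : ℝ) : 0 ≤ stabilityConst k t a b :=
  mul_nonneg (mul_nonneg two_pos.le (by linarith [gaussRadauConst_nonneg k t])) (sq_nonneg _)

namespace Mesh

variable {a b : ℝ} {N k : ℕ} (M : Mesh a b N)

/-- The primitive vanishing at `a` of a piecewise polynomial function. Its Gauss-Radau projection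
is a preimage under `D_{h,θ}`. -/
def primitive (z : DGSpace N k) (x : ℝ) : ℝ := ∫ y in a..x, M.toFun z y

theorem primitive_left (z : DGSpace N k) : M.primitive z a = 0 := intervalIntegral.integral_same

theorem primitive_right {z : DGSpace N k} (hz : z ∈ M.zeroMean) : M.primitive z b = 0 :=
  (M.integral_toFun z).trans hz

theorem absolutelyContinuousOnInterval_primitive (z : DGSpace N k) :
    AbsolutelyContinuousOnInterval (M.primitive z) a b :=
  (M.intervalIntegrable_toFun z).absolutelyContinuousOnInterval_intervalIntegral Set.left_mem_uIcc

theorem deriv_primitive_eqOn_cell (z : DGSpace N k) (j : Fin N) :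
    Set.EqOn (deriv (M.primitive z)) (fun x => (z j : ℝ[X]).eval x)
      (Set.uIoo (M.left j) (M.right j)) := by
  intro x hx
  have hcont : ContinuousOn (M.toFun z) (Set.uIoo (M.left j) (M.right j)) :=
    (z j : ℝ[X]).continuous.continuousOn.congr (M.toFun_eqOn_cell z j)
  have hsub : Set.uIcc a x ⊆ Set.uIcc a b := Set.uIcc_subset_uIcc Set.left_mem_uIcc
    (M.uIcc_cell_subset j (Set.uIoo_subset_uIcc_self hx))
  rw [← M.toFun_eqOn_cell z j hx]
  exact (intervalIntegral.integral_hasDerivAt_right ((M.intervalIntegrable_toFun z).mono_set hsub)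
    (hcont.stronglyMeasurableAtFilter isOpen_Ioo x hx)
    (hcont.continuousAt (isOpen_Ioo.mem_nhds hx))).deriv

theorem proj₀_deriv_primitive (z : DGSpace N k) : M.proj₀ k (deriv (M.primitive z)) = z :=
  M.proj₀_eq_of_eqOn_cells (M.deriv_primitive_eqOn_cell z)

theorem intervalIntegrable_toFun_sq (z : DGSpace N k) :
    IntervalIntegrable (fun x => M.toFun z x ^ 2) volume a b := by
  simpa only [sq] using M.intervalIntegrable_mul_toFun (M.intervalIntegrable_toFun z) z

theorem sub_primitive_sq_le (z : DGSpace N k) {l r x : ℝ} (hl : a ≤ l) (hr : r ≤ b)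
    (hx : x ∈ Set.Icc l r) : (M.primitive z x - M.primitive z l) ^ 2 ≤
      (r - l) * ∫ y in l..r, M.toFun z y ^ 2 := by
  have hsub : ∀ {y y'}, y ∈ Set.Icc a b → y' ∈ Set.Icc a b → Set.uIcc y y' ⊆ Set.uIcc a b :=
    fun hy hy' => Set.uIcc_subset_uIcc (Set.Icc_subset_uIcc hy) (Set.Icc_subset_uIcc hy')
  have hab := M.le
  have hl' : l ∈ Set.Icc a b := ⟨hl, (hx.1.trans hx.2).trans hr⟩
  have hr' : r ∈ Set.Icc a b := ⟨hl.trans (hx.1.trans hx.2), hr⟩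
  have hx' : x ∈ Set.Icc a b := ⟨hl.trans hx.1, hx.2.trans hr⟩
  have ha' : a ∈ Set.Icc a b := Set.left_mem_Icc.2 hab
  have hint := M.intervalIntegrable_toFun z
  have hint2 := M.intervalIntegrable_toFun_sq z
  rw [primitive, primitive, intervalIntegral.integral_interval_sub_left
    (hint.mono_set (hsub ha' hx')) (hint.mono_set (hsub ha' hl'))]
  refine (sq_intervalIntegral_le hx.1 (hint.mono_set (hsub hl' hx'))
    (hint2.mono_set (hsub hl' hx'))).trans (mul_le_mul (by linarith [hx.2]) ?_ ?_ ?_)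
  · exact intervalIntegral.integral_mono_interval le_rfl hx.1 hx.2
      (Filter.Eventually.of_forall fun y => sq_nonneg _) (hint2.mono_set (hsub hl' hr'))
  · exact intervalIntegral.integral_nonneg hx.1 fun _ _ => sq_nonneg _
  · linarith [hx.1, hx.2]

theorem integral_primitive_sq_le (z : DGSpace N k) :
    ∫ x in a..b, M.primitive z x ^ 2 ≤ (b - a) ^ 2 * M.inner z z := by
  calc ∫ x in a..b, M.primitive z x ^ 2 ≤ ∫ _ in a..b, (b - a) * M.inner z z := by
        refine intervalIntegral.integral_mono_on M.le
          ((M.absolutelyContinuousOnInterval_primitive z).continuousOn.pow 2).intervalIntegrable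
          intervalIntegrable_const fun x hx => ?_
        simpa only [primitive_left, sub_zero, integral_toFun_sq] using
          M.sub_primitive_sq_le z le_rfl le_rfl hx
    _ = (b - a) ^ 2 * M.inner z z := by rw [intervalIntegral.integral_const, smul_eq_mul]; ring

variable [NeZero N]

theorem approxOnCells_primitive (z : DGSpace N k) : M.ApproxOnCells k (M.primitive z)
    fun j => M.size * ∫ x in M.left j..M.right j, M.toFun z x ^ 2 := fun j => by
  refine ⟨C (M.primitive z (M.left j)),
    degree_C_le.trans_lt (Nat.cast_pos.2 k.succ_pos), fun x hx => ?_⟩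
  rw [eval_C]
  exact (M.sub_primitive_sq_le z (M.le_left j) (M.right_le j) hx).trans
    (mul_le_mul_of_nonneg_right (M.width_le_size j)
      (intervalIntegral.integral_nonneg (M.left_lt_right j).le fun _ _ => sq_nonneg _))

theorem exists_D_eq {t : ℝ} (ht : t ≠ 1 / 2) {z : DGSpace N k} (hz : z ∈ M.zeroMean) :
    ∃ y ∈ M.zeroMean, M.D k t y = z ∧ M.inner y y ≤ stabilityConst k t a b * M.inner z z := by
  set φ := M.primitive z
  have hac := M.absolutelyContinuousOnInterval_primitive z
  have hφ : IntervalIntegrable φ volume a b := hac.continuousOn.intervalIntegrable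
  have hφ2 : IntervalIntegrable (fun x => φ x ^ 2) volume a b :=
    (hac.continuousOn.pow 2).intervalIntegrable
  have hper : φ a = φ b := (M.primitive_left z).trans (M.primitive_right hz).symm
  obtain ⟨p, hp, hle⟩ := (M.approxOnCells_primitive z).exists_isGaussRadau hφ hφ2 hper ht
  refine ⟨M.zeroMeanProj p, M.zeroMeanProj_mem p, ?_, (M.inner_zeroMeanProj_self_le p).trans ?_⟩
  · rw [D_zeroMeanProj, hp.D_eq hac hper, proj₀_deriv_primitive]
  rw [← Finset.mul_sum, M.sum_integral_cells (M.intervalIntegrable_toFun_sq z),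
    integral_toFun_sq] at hle
  have hzz := M.inner_self_nonneg z
  have hK := gaussRadauConst_nonneg k t
  calc M.inner p p = M.inner (p - M.proj₀ k φ + M.proj₀ k φ) (p - M.proj₀ k φ + M.proj₀ k φ) := by
        rw [sub_add_cancel]
    _ ≤ 2 * M.inner (p - M.proj₀ k φ) (p - M.proj₀ k φ) +
          2 * M.inner (M.proj₀ k φ) (M.proj₀ k φ) := M.inner_add_self_le _ _
    _ ≤ 2 * (gaussRadauConst k t * (b - a) * ((b - a) * M.inner z z)) +
          2 * ((b - a) ^ 2 * M.inner z z) := by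
        have hproj := (M.inner_proj₀_self_le (k := k) hφ hφ2).trans (M.integral_primitive_sq_le z)
        have hpos := M.size_pos.le
        have hsize := M.size_le
        have hba := hpos.trans hsize
        gcongr
        exact hle.trans (by gcongr)
    _ = stabilityConst k t a b * M.inner z z := by rw [stabilityConst]; ring

theorem bijOn_D {t : ℝ} (ht : t ≠ 1 / 2) : Set.BijOn (M.D k t) M.zeroMean M.zeroMean := by
  refine ⟨fun w _ => M.D_mem_zeroMean t w, fun w hw w' hw' h => ?_, fun z hz => ?_⟩
  · have hsub : w - w' ∈ M.zeroMean := by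
      rw [mem_zeroMean_iff, LinearMap.map_sub₂, M.mem_zeroMean_iff.1 hw, M.mem_zeroMean_iff.1 hw',
        sub_zero]
    obtain ⟨y, -, hy, -⟩ := M.exists_D_eq (t := 1 - t) (fun h => ht (by linarith)) hsub
    have horth := M.inner_D_left t (w - w') y
    rw [hy, map_sub (M.D k t), h, sub_self, LinearMap.map_zero₂] at horth
    exact sub_eq_zero.1 (M.inner_self_eq_zero (neg_eq_zero.1 horth.symm))
  · obtain ⟨y, hy, hyz, -⟩ := M.exists_D_eq ht hz
    exact ⟨y, hy, hyz⟩

theorem inner_self_le_inner_D {t : ℝ} (ht : t ≠ 1 / 2) {y : DGSpace N k} (hy : y ∈ M.zeroMean) :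
    M.inner y y ≤ stabilityConst k t a b * M.inner (M.D k t y) (M.D k t y) := by
  obtain ⟨y', hy', hD, hle⟩ := M.exists_D_eq ht (M.D_mem_zeroMean t y)
  rwa [(M.bijOn_D ht).injOn hy' hy hD] at hle

theorem Dinv_mem {t : ℝ} (ht : t ≠ 1 / 2) {z : DGSpace N k} (hz : z ∈ M.zeroMean) :
    M.Dinv k t z ∈ M.zeroMean :=
  Function.invFunOn_mem ((M.bijOn_D ht).surjOn hz)

theorem D_Dinv {t : ℝ} (ht : t ≠ 1 / 2) {z : DGSpace N k} (hz : z ∈ M.zeroMean) :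
    M.D k t (M.Dinv k t z) = z :=
  Function.invFunOn_eq ((M.bijOn_D ht).surjOn hz)

end Mesh

namespace Mesh

variable {a b : ℝ} {N k : ℕ} {M : Mesh a b N} [NeZero N]

theorem ApproxOnCells.inner_Dinv_sub_self_le {u : ℝ → ℝ} {d : Fin N → ℝ}
    (hd : M.ApproxOnCells k u d) (hac : AbsolutelyContinuousOnInterval u a b) (hper : u a = u b)
    {t : ℝ} (ht : t ≠ 1 / 2) {z : DGSpace N k} (hz : z ∈ M.zeroMean) :
    M.inner (M.Dinv k t z - M.zeroMeanProj (M.proj₀ k u))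
        (M.Dinv k t z - M.zeroMeanProj (M.proj₀ k u)) ≤
      2 * (stabilityConst k t a b * M.inner (z - M.proj₀ k (deriv u)) (z - M.proj₀ k (deriv u))) +
        2 * (gaussRadauConst k t * M.size * ∑ j, d j) := by
  obtain ⟨p, hp, hle⟩ := hd.exists_isGaussRadau hac.continuousOn.intervalIntegrable
    (hac.continuousOn.pow 2).intervalIntegrable hper ht
  set y := M.Dinv k t z
  have hy : y - M.zeroMeanProj p ∈ M.zeroMean := by
    rw [← M.zeroMeanProj_of_mem (show y ∈ M.zeroMean from M.Dinv_mem ht hz), ← map_sub]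
    exact M.zeroMeanProj_mem _
  have hDy : M.D k t (y - M.zeroMeanProj p) = z - M.proj₀ k (deriv u) := by
    rw [map_sub, M.D_Dinv ht hz, D_zeroMeanProj, hp.D_eq hac hper]
  have hsplit : y - M.zeroMeanProj (M.proj₀ k u) =
      (y - M.zeroMeanProj p) + M.zeroMeanProj (p - M.proj₀ k u) := by
    rw [map_sub, sub_add_sub_cancel]
  rw [hsplit, ← hDy]
  exact (M.inner_add_self_le _ _).trans (add_le_add
    (mul_le_mul_of_nonneg_left (M.inner_self_le_inner_D ht hy) two_pos.le)
    (mul_le_mul_of_nonneg_left ((M.inner_zeroMeanProj_self_le _).trans hle) two_pos.le))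

end Mesh

/-! ### Periodic Sobolev functions -/

theorem l2norm_sq {a b : ℝ} (hab : a ≤ b) (f : ℝ → ℝ) : l2norm a b f ^ 2 = ∫ x in a..b, f x ^ 2 :=
  Real.sq_sqrt (intervalIntegral.integral_nonneg hab fun _ _ => sq_nonneg _)

theorem sobolevNorm_nonneg (a b : ℝ) (m : ℕ) (w : ℝ → ℝ) : 0 ≤ sobolevNorm a b m w :=
  Real.sqrt_nonneg _

theorem sobolevNorm_mono (a b : ℝ) {m n : ℕ} (hmn : m ≤ n) (w : ℝ → ℝ) :
    sobolevNorm a b m w ≤ sobolevNorm a b n w :=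
  Real.sqrt_le_sqrt <| Finset.sum_le_sum_of_subset_of_nonneg
    (Finset.range_mono (Nat.succ_le_succ hmn)) fun _ _ _ => sq_nonneg _

theorem integral_iteratedDeriv_sq_le_sobolevNorm_sq {a b : ℝ} (hab : a ≤ b) {i m : ℕ} (hi : i ≤ m)
    (w : ℝ → ℝ) : ∫ x in a..b, iteratedDeriv i w x ^ 2 ≤ sobolevNorm a b m w ^ 2 := by
  rw [← l2norm_sq hab, sobolevNorm, Real.sq_sqrt (Finset.sum_nonneg fun _ _ => sq_nonneg _)]
  exact Finset.single_le_sum (f := fun i => l2norm a b (iteratedDeriv i w) ^ 2)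
    (fun _ _ => sq_nonneg _) (Finset.mem_range.2 (Nat.lt_succ_of_le hi))

namespace MemPeriodicSobolev

variable {a b : ℝ} {i k m : ℕ} {w : ℝ → ℝ}

theorem mono {n : ℕ} (hw : MemPeriodicSobolev a b n w) (hmn : m ≤ n) :
    MemPeriodicSobolev a b m w where
  periodic := hw.periodic
  contDiff i hi := hw.contDiff i (hi.trans_le hmn)
  absCont i hi := hw.absCont i (hi.trans_le hmn)
  memLp i hi := hw.memLp i (hi.trans hmn)

variable (hw : MemPeriodicSobolev a b m w)

include hw

theorem iteratedDeriv_left_eq_right (i : ℕ) : iteratedDeriv i w a = iteratedDeriv i w b := by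
  have h := congrFun (iteratedDeriv_comp_add_const i w (b - a)) a
  rwa [funext hw.periodic, add_sub_cancel] at h

theorem intervalIntegrable_iteratedDeriv (hab : a ≤ b) (hi : i ≤ m) :
    IntervalIntegrable (iteratedDeriv i w) volume a b :=
  (intervalIntegrable_iff_integrableOn_Ioc_of_le hab).2 ((hw.memLp i hi).integrable one_le_two)

theorem intervalIntegrable_iteratedDeriv_sq (hab : a ≤ b) (hi : i ≤ m) :
    IntervalIntegrable (fun x => iteratedDeriv i w x ^ 2) volume a b :=
  (intervalIntegrable_iff_integrableOn_Ioc_of_le hab).2 (hw.memLp i hi).integrable_sq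

theorem integral_iteratedDeriv_succ (hi : i < m) :
    ∫ x in a..b, iteratedDeriv (i + 1) w x = 0 := by
  rw [iteratedDeriv_succ, (hw.absCont i hi).integral_deriv_eq_sub,
    hw.iteratedDeriv_left_eq_right i, sub_self]

theorem proj₀_iteratedDeriv_mem_zeroMean {N : ℕ} (M : Mesh a b N) (hi₀ : 1 ≤ i) (hi : i ≤ m) :
    M.proj₀ k (iteratedDeriv i w) ∈ M.zeroMean := by
  obtain ⟨n, rfl⟩ := Nat.exists_eq_add_of_le' hi₀
  exact M.proj₀_mem_zeroMean (hw.intervalIntegrable_iteratedDeriv M.le hi)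
    (hw.integral_iteratedDeriv_succ hi)

theorem exists_approxOnCells_iteratedDeriv {N : ℕ} [NeZero N] (M : Mesh a b N) (hi : k + i < m) :
    ∃ d : Fin N → ℝ, M.ApproxOnCells k (iteratedDeriv i w) d ∧
      M.size * ∑ j, d j ≤ M.size ^ (2 * (k + 1)) * sobolevNorm a b m w ^ 2 := by
  have hderiv : ∀ n, iteratedDeriv n (iteratedDeriv i w) = iteratedDeriv (n + i) w := fun n => by
    simp only [iteratedDeriv_eq_iterate, Function.iterate_add_apply]
  have hL2 : IntervalIntegrable (fun x => iteratedDeriv (k + 1 + i) w x ^ 2) volume a b :=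
    hw.intervalIntegrable_iteratedDeriv_sq M.le (by lia)
  refine ⟨fun j => M.size ^ (2 * k + 1) *
    ∫ x in M.left j..M.right j, iteratedDeriv (k + 1 + i) w x ^ 2, fun j => ?_, ?_⟩
  · have hlr := (M.left_lt_right j).le
    obtain ⟨T, hdeg, hT⟩ := exists_degree_lt_sub_sq_le (f := iteratedDeriv i w) (n := k) hlr
      (by rw [iteratedDeriv_eq_iterate]; exact (hw.contDiff (k + i) hi).iterate_deriv' k i)
      (by rw [hderiv]; exact (hw.absCont (k + i) hi).mono (M.uIcc_cell_subset j))
      (by rw [hderiv]; exact M.intervalIntegrable_cell hL2 j)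
    rw [hderiv] at hT
    exact ⟨T, hdeg, fun x hx => (hT x hx).trans <| mul_le_mul_of_nonneg_right
      (pow_le_pow_left₀ (M.width_pos j).le (M.width_le_size j) _)
      (intervalIntegral.integral_nonneg hlr fun _ _ => sq_nonneg _)⟩
  · rw [← Finset.mul_sum, M.sum_integral_cells hL2, ← mul_assoc, ← pow_succ',
      show 2 * k + 1 + 1 = 2 * (k + 1) by ring]
    exact mul_le_mul_of_nonneg_left
      (integral_iteratedDeriv_sq_le_sobolevNorm_sq M.le (by lia) w) (pow_nonneg M.size_pos.le _)

end MemPeriodicSobolev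

/-! ### Compositions of the inverses -/

namespace Mesh

variable {a b : ℝ} {N k : ℕ} (M : Mesh a b N) [NeZero N]

/-- The composition of the inverses `D_{h,t}⁻¹` for `t` in the list `l`, where the inverse for the
head of the list is applied first. -/
def foldDinv (l : List ℝ) (z : DGSpace N k) : DGSpace N k := l.foldl (fun y t => M.Dinv k t y) z

variable {l : List ℝ} {z : DGSpace N k}

theorem foldDinv_cons (t : ℝ) (l : List ℝ) (z : DGSpace N k) :
    M.foldDinv (t :: l) z = M.foldDinv l (M.Dinv k t z) := rfl

theorem foldDinv_append (l l' : List ℝ) (z : DGSpace N k) :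
    M.foldDinv (l ++ l') z = M.foldDinv l' (M.foldDinv l z) := List.foldl_append

theorem prod_D_foldDinv (hl : ∀ t ∈ l, t ≠ 1 / 2) (hz : z ∈ M.zeroMean) :
    (l.map (M.D k)).prod (M.foldDinv l z) = z := by
  induction l generalizing z with
  | nil => rfl
  | cons t l ih =>
    obtain ⟨ht, hl⟩ := List.forall_mem_cons.1 hl
    rw [List.map_cons, List.prod_cons, Module.End.mul_apply, foldDinv_cons,
      ih hl (M.Dinv_mem ht hz), M.D_Dinv ht hz]

end Mesh

namespace MemPeriodicSobolev

variable {a b : ℝ} {N k m : ℕ} [NeZero N] {M : Mesh a b N} {w : ℝ → ℝ} {z : DGSpace N k}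

theorem inner_Dinv_sub_self_le {i : ℕ} {t : ℝ}
    (hw : MemPeriodicSobolev a b m w) (hi : k + i < m) (ht : t ≠ 1 / 2) (hz : z ∈ M.zeroMean) :
    M.inner (M.Dinv k t z - M.zeroMeanProj (M.proj₀ k (iteratedDeriv i w)))
        (M.Dinv k t z - M.zeroMeanProj (M.proj₀ k (iteratedDeriv i w))) ≤
      2 * (stabilityConst k t a b + gaussRadauConst k t) *
        (M.inner (z - M.zeroMeanProj (M.proj₀ k (iteratedDeriv (i + 1) w)))
            (z - M.zeroMeanProj (M.proj₀ k (iteratedDeriv (i + 1) w))) +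
          M.size ^ (2 * (k + 1)) * sobolevNorm a b m w ^ 2) := by
  obtain ⟨d, hd, hle⟩ := hw.exists_approxOnCells_iteratedDeriv M hi
  have him : i < m := by lia
  refine (hd.inner_Dinv_sub_self_le (hw.absCont i him) (hw.iteratedDeriv_left_eq_right i) ht
    hz).trans ?_
  rw [M.zeroMeanProj_of_mem (hw.proj₀_iteratedDeriv_mem_zeroMean M i.succ_pos him),
    ← iteratedDeriv_succ, mul_assoc]
  have hX := M.inner_self_nonneg (z - M.proj₀ k (iteratedDeriv (i + 1) w))
  have hS := stabilityConst_nonneg k t a b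
  have hG := gaussRadauConst_nonneg k t
  have hE : 0 ≤ M.size ^ (2 * (k + 1)) * sobolevNorm a b m w ^ 2 := by
    have := M.size_pos; positivity
  nlinarith [mul_le_mul_of_nonneg_left hle hG, mul_nonneg hS hE, mul_nonneg hG hX]

theorem exists_inner_foldDinv_sub_le (a b : ℝ) (k : ℕ) {l : List ℝ} (hl : ∀ t ∈ l, t ≠ 1 / 2) :
    ∃ C, 0 ≤ C ∧ ∀ {N : ℕ} [NeZero N] {M : Mesh a b N} {m : ℕ} {w : ℝ → ℝ} {z : DGSpace N k},
      MemPeriodicSobolev a b m w → k + l.length ≤ m → z ∈ M.zeroMean →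
      M.inner (M.foldDinv l z - M.zeroMeanProj (M.proj₀ k w))
          (M.foldDinv l z - M.zeroMeanProj (M.proj₀ k w)) ≤
        C * (M.inner (z - M.zeroMeanProj (M.proj₀ k (iteratedDeriv l.length w)))
            (z - M.zeroMeanProj (M.proj₀ k (iteratedDeriv l.length w))) +
          M.size ^ (2 * (k + 1)) * sobolevNorm a b m w ^ 2) := by
  induction l with
  | nil =>
    refine ⟨1, zero_le_one, fun {N _ M m w z} _ _ _ => ?_⟩
    rw [one_mul, List.length_nil, iteratedDeriv_zero]
    exact le_add_of_nonneg_right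
      (mul_nonneg (pow_nonneg M.size_pos.le _) (sq_nonneg _))
  | cons t l ih =>
    obtain ⟨ht, hl⟩ := List.forall_mem_cons.1 hl
    obtain ⟨C, hC, ih⟩ := ih hl
    set c := 2 * (stabilityConst k t a b + gaussRadauConst k t)
    have hc : 0 ≤ c := mul_nonneg two_pos.le
      (add_nonneg (stabilityConst_nonneg k t a b) (gaussRadauConst_nonneg k t))
    refine ⟨C * (c + 1), by positivity, fun {N _ M m w z} hw hm hz => ?_⟩
    rw [List.length_cons] at hm ⊢
    have hstep := hw.inner_Dinv_sub_self_le (by lia : k + l.length < m) ht hz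
    have hX := M.inner_self_nonneg (z - M.zeroMeanProj (M.proj₀ k (iteratedDeriv (l.length + 1) w)))
    refine (ih hw (by lia) (M.Dinv_mem ht hz)).trans ?_
    rw [mul_assoc]
    exact mul_le_mul_of_nonneg_left (by linarith) hC

theorem exists_l2norm_sub_foldDinv_le (a b : ℝ) (k : ℕ) {l : List ℝ} (hl₀ : l ≠ [])
    (hl : ∀ t ∈ l, t ≠ 1 / 2) :
    ∃ C, 0 < C ∧ ∀ {N : ℕ} [NeZero N] {M : Mesh a b N} {w : ℝ → ℝ},
      MemPeriodicSobolev a b (k + l.length) w →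
      l2norm a b (fun x => w x - M.toFun (M.foldDinv l (M.proj₀ k (iteratedDeriv l.length w)) +
          Mesh.const N k ((∫ x in a..b, w x) / ∫ _x in a..b, (1 : ℝ))) x) ≤
        C * sobolevNorm a b (k + l.length) w * M.size ^ (k + 1) := by
  obtain ⟨C, hC, hfold⟩ := exists_inner_foldDinv_sub_le a b k hl
  have hlen : 0 < l.length := List.length_pos_of_ne_nil hl₀
  refine ⟨√(1 + C), by positivity, fun {N _ M w} hw => ?_⟩
  have hz : M.proj₀ k (iteratedDeriv l.length w) ∈ M.zeroMean :=
    hw.proj₀_iteratedDeriv_mem_zeroMean M hlen (Nat.le_add_left _ _)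
  have hint := hw.intervalIntegrable_iteratedDeriv M.le (Nat.zero_le _)
  have hint2 := hw.intervalIntegrable_iteratedDeriv_sq M.le (Nat.zero_le _)
  obtain ⟨d, hd, hsum⟩ := hw.exists_approxOnCells_iteratedDeriv (k := k) (i := 0) M (by lia)
  rw [iteratedDeriv_zero] at hint hint2 hd
  have hproj := (hd.integral_sub_proj₀_sq_le hint hint2).trans hsum
  have hdisc := hfold hw le_rfl hz
  rw [M.zeroMeanProj_of_mem hz, sub_self, map_zero, zero_add, M.zeroMeanProj_proj₀ hint,
    sub_sub_eq_add_sub] at hdisc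
  refine le_of_sq_le_sq ?_ (mul_nonneg (mul_nonneg (Real.sqrt_nonneg _) (sobolevNorm_nonneg ..))
    (pow_nonneg M.size_pos.le _))
  calc
    l2norm a b (fun x => w x - M.toFun (M.foldDinv l (M.proj₀ k (iteratedDeriv l.length w)) +
          Mesh.const N k ((∫ x in a..b, w x) / ∫ _x in a..b, (1 : ℝ))) x) ^ 2
    _ ≤ M.size ^ (2 * (k + 1)) * sobolevNorm a b (k + l.length) w ^ 2 +
        C * (M.size ^ (2 * (k + 1)) * sobolevNorm a b (k + l.length) w ^ 2) := by
      rw [l2norm_sq M.le, M.integral_sq_sub_toFun_eq_add hint hint2]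
      exact add_le_add hproj hdisc
    _ = (√(1 + C) * sobolevNorm a b (k + l.length) w * M.size ^ (k + 1)) ^ 2 := by
      rw [mul_pow, mul_pow, Real.sq_sqrt (add_nonneg zero_le_one hC)]
      ring

end MemPeriodicSobolev

/-! ### The scheme `L_h` as a product -/

section FluxWeights

theorem length_thetaList (θ : ℕ → ℝ) (γ : ℕ) : (Mesh.thetaList θ γ).length = γ := by
  rw [Mesh.thetaList, List.length_map, List.length_range']

theorem thetaList_ne_half {θ : ℕ → ℝ} {γ : ℕ} (hθ : ∀ i, 1 ≤ i → i ≤ γ → θ i ≠ 1 / 2) :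
    ∀ t ∈ Mesh.thetaList θ γ, t ≠ 1 / 2 := by
  intro t ht
  obtain ⟨i, hi, rfl⟩ := List.mem_map.1 ht
  rw [List.mem_range'_1] at hi
  exact hθ i hi.1 (by lia)

/-- The flux parameters `1 - θ_γ, …, 1 - θ₁, (θ₀,) θ₁, …, θ_γ`, where `θ₀` is present only for
odd `q`: the scheme `L_h` is `β` times the product of the corresponding operators `D_{h,t}`. -/
def fluxList (q : ℕ) (θ : ℕ → ℝ) : List ℝ :=
  ((Mesh.thetaList θ (q / 2)).map (1 - ·)).reverse ++
    ((if Even q then [] else [θ 0]) ++ Mesh.thetaList θ (q / 2))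

theorem length_fluxList (q : ℕ) (θ : ℕ → ℝ) : (fluxList q θ).length = q := by
  rw [fluxList, List.length_append, List.length_append, List.length_reverse, List.length_map,
    length_thetaList]
  split_ifs with h
  · have := Nat.even_iff.1 h
    rw [List.length_nil]
    lia
  · have := Nat.not_even_iff.1 h
    rw [List.length_singleton]
    lia

theorem fluxList_ne_half {q : ℕ} {θ : ℕ → ℝ} (hθ : ∀ i, 1 ≤ i → i ≤ q / 2 → θ i ≠ 1 / 2)
    (hθ₀ : Odd q → θ 0 ≠ 1 / 2) : ∀ t ∈ fluxList q θ, t ≠ 1 / 2 := by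
  intro t ht
  rcases List.mem_append.1 ht with ht | ht
  · obtain ⟨s, hs, rfl⟩ := List.mem_map.1 (List.mem_reverse.1 ht)
    exact fun h => thetaList_ne_half hθ s hs (by linarith)
  rcases List.mem_append.1 ht with ht | ht
  · split_ifs at ht with h
    · exact absurd ht List.not_mem_nil
    · exact List.mem_singleton.1 ht ▸ hθ₀ (Nat.not_even_iff_odd.1 h)
  · exact thetaList_ne_half hθ t ht

end FluxWeights

namespace Mesh

variable {a b : ℝ} {N k : ℕ} (M : Mesh a b N)

theorem inner_transpose (A : Module.End ℝ (DGSpace N k)) (v w : DGSpace N k) :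
    M.inner (M.transpose A v) w = M.inner v (A w) :=
  LinearMap.BilinForm.isAdjointPairLeftAdjointOfNondegenerate M.inner M.inner_nondegenerate A v w

theorem transpose_one : M.transpose (1 : Module.End ℝ (DGSpace N k)) = 1 :=
  LinearMap.ext fun v => M.ext_inner fun w => M.inner_transpose 1 v w

theorem transpose_mul (A B : Module.End ℝ (DGSpace N k)) :
    M.transpose (A * B) = M.transpose B * M.transpose A :=
  LinearMap.ext fun v => M.ext_inner fun w => by
    rw [inner_transpose, Module.End.mul_apply, Module.End.mul_apply, inner_transpose,
      inner_transpose]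

variable [NeZero N]

theorem transpose_D (t : ℝ) : M.transpose (M.D k t) = -M.D k (1 - t) :=
  LinearMap.ext fun v => M.ext_inner fun w => by
    rw [inner_transpose, M.inner_comm, inner_D_left, LinearMap.neg_apply, LinearMap.map_neg₂,
      M.inner_comm w]

theorem transpose_prod_D (l : List ℝ) :
    M.transpose (l.map (M.D k)).prod =
      (-1 : ℝ) ^ l.length • ((l.map (1 - ·)).reverse.map (M.D k)).prod := by
  induction l with
  | nil =>
    rw [List.length_nil, pow_zero, one_smul]
    exact M.transpose_one
  | cons t l ih =>
    have hD : M.transpose (M.D k t) = (-1 : ℝ) • M.D k (1 - t) :=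
      LinearMap.ext fun v => by
        rw [transpose_D, LinearMap.neg_apply, LinearMap.smul_apply, neg_one_smul]
    rw [List.map_cons, List.prod_cons, transpose_mul, ih, hD, smul_mul_smul_comm, List.map_cons,
      List.reverse_cons, List.map_append, List.prod_append, List.map_singleton,
      List.prod_singleton, List.length_cons, pow_succ]

theorem prod_D_const {l : List ℝ} (hl : l ≠ []) (c : ℝ) :
    (l.map (M.D k)).prod (const N k c) = 0 := by
  rw [← List.dropLast_append_getLast hl, List.map_append, List.prod_append, List.map_singleton,
    List.prod_singleton, Module.End.mul_apply, D_const, map_zero]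

theorem Lh_eq_smul_prod_D (k q : ℕ) (β : ℝ) (θ : ℕ → ℝ) :
    M.Lh k q β θ = β • ((fluxList q θ).map (M.D k)).prod := by
  have hsign : (-1 : ℝ) ^ (q / 2) * β * (-1) ^ (q / 2) = β := by
    rw [mul_right_comm, ← mul_pow, neg_one_mul, neg_neg, one_pow, one_mul]
  rw [Lh, K, transpose_prod_D, length_thetaList, fluxList, List.map_append, List.prod_append]
  split_ifs
  · rw [smul_mul_assoc, smul_smul, hsign, List.nil_append]
  · rw [mul_assoc, smul_mul_assoc, smul_smul, hsign, List.singleton_append, List.map_cons,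
      List.prod_cons]

theorem ldgProj_eq_foldDinv_add_const (k q : ℕ) (θ : ℕ → ℝ) (w : ℝ → ℝ) :
    M.ldgProj k q θ w = M.foldDinv (fluxList q θ) (M.proj₀ k (iteratedDeriv q w)) +
      const N k ((∫ x in a..b, w x) / ∫ _x in a..b, (1 : ℝ)) := by
  have hinner : ∀ z : DGSpace N k,
      M.foldDinv ((thetaList θ (q / 2)).map (1 - ·)).reverse z = M.innerInv k (q / 2) θ z :=
    fun z => by rw [foldDinv, List.foldl_reverse, List.foldr_map, innerInv]
  rw [ldgProj, fluxList, foldDinv_append, hinner]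
  split_ifs <;> rfl

variable {q : ℕ} {θ : ℕ → ℝ} {w : ℝ → ℝ}

theorem Lh_ldgProj (hq : 1 ≤ q) (hθ : ∀ i, 1 ≤ i → i ≤ q / 2 → θ i ≠ 1 / 2)
    (hθ₀ : Odd q → θ 0 ≠ 1 / 2) (hz : M.proj₀ k (iteratedDeriv q w) ∈ M.zeroMean) (β : ℝ) :
    M.Lh k q β θ (M.ldgProj k q θ w) = β • M.proj₀ k (iteratedDeriv q w) := by
  have hne : fluxList q θ ≠ [] := List.ne_nil_of_length_pos (by rwa [length_fluxList])
  rw [Lh_eq_smul_prod_D, ldgProj_eq_foldDinv_add_const, LinearMap.smul_apply, map_add,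
    M.prod_D_foldDinv (fluxList_ne_half hθ hθ₀) hz, M.prod_D_const hne, add_zero]

end Mesh

end LDG

end

theorem mainTheorem3_general (a b : ℝ) (k q : ℕ) (hq : 1 ≤ q) (θ : ℕ → ℝ)
    (hθ : ∀ i, 1 ≤ i → i ≤ q / 2 → θ i ≠ 1 / 2) (hθ₀ : Odd q → θ 0 ≠ 1 / 2) :
    ∃ C : ℝ, 0 < C ∧ ∀ (N : ℕ) [NeZero N] (M : LDG.Mesh a b N),
      (∀ t : ℝ, t ≠ 1 / 2 → Set.BijOn (M.D k t) M.zeroMean M.zeroMean) ∧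
      ∀ w : ℝ → ℝ, LDG.MemPeriodicSobolev a b (k + q) w →
        M.proj₀ k (iteratedDeriv q w) ∈ M.zeroMean ∧
        LDG.l2norm a b (fun x => w x - M.toFun (M.ldgProj k q θ w) x) ≤
          C * LDG.sobolevNorm a b (k + q) w * M.size ^ (k + 1) ∧
        ∀ β : ℝ,
          M.Lh k q β θ (M.ldgProj k q θ w) = M.proj₀ k (LDG.diffOp β q w) ∧
          ∀ v : LDG.DGSpace N k,
            (∫ x in a..b, (LDG.diffOp β q w x - M.toFun (M.Lh k q β θ (M.ldgProj k q θ w)) x) *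
              M.toFun v x) = 0 := by
  have hlen := LDG.length_fluxList q θ
  obtain ⟨C, hC, herr⟩ := LDG.MemPeriodicSobolev.exists_l2norm_sub_foldDinv_le a b k
    (List.ne_nil_of_length_pos (hq.trans_eq hlen.symm)) (LDG.fluxList_ne_half hθ hθ₀)
  rw [hlen] at herr
  refine ⟨C, hC, fun N _ M => ⟨fun t ht => M.bijOn_D ht, fun w hw => ?_⟩⟩
  have hz : M.proj₀ k (iteratedDeriv q w) ∈ M.zeroMean :=
    hw.proj₀_iteratedDeriv_mem_zeroMean M hq (Nat.le_add_left q k)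
  have hint := hw.intervalIntegrable_iteratedDeriv M.le (Nat.le_add_left q k)
  refine ⟨hz, ?_, fun β => ?_⟩
  · rw [M.ldgProj_eq_foldDinv_add_const]
    exact herr hw
  · have hLh : M.Lh k q β θ (M.ldgProj k q θ w) = M.proj₀ k (LDG.diffOp β q w) :=
      (M.Lh_ldgProj hq hθ hθ₀ hz β).trans (M.proj₀_const_mul hint β).symm
    exact ⟨hLh, fun v => hLh ▸ M.integral_sub_proj₀_mul_toFun (hint.const_mul β) v⟩

theorem mainTheorem3 (a b : ℝ) (hab : a < b) (k q : ℕ) (hq : 1 ≤ q) (θ : ℕ → ℝ)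
    (hθ : ∀ i, 1 ≤ i → i ≤ q / 2 → θ i ≠ 1 / 2) (hθ₀ : Odd q → θ 0 ≠ 1 / 2) (σ : ℝ) :
    ∃ C : ℝ, 0 < C ∧ ∀ (N : ℕ) [NeZero N] (M : LDG.Mesh a b N), M.QuasiUniform σ →
      -- the inverses that enter `Π` are well defined
      (∀ t : ℝ, t ≠ 1 / 2 → Set.BijOn (M.D k t) M.zeroMean M.zeroMean) ∧
      ∀ w : ℝ → ℝ, LDG.MemPeriodicSobolev a b (k + 1 + q) w →
        M.proj₀ k (iteratedDeriv q w) ∈ M.zeroMean ∧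
        LDG.l2norm a b (fun x => w x - M.toFun (M.ldgProj k q θ w) x) ≤
          C * LDG.sobolevNorm a b (k + 1 + q) w * M.size ^ (k + 1) ∧
        ∀ β : ℝ,
          M.Lh k q β θ (M.ldgProj k q θ w) = M.proj₀ k (LDG.diffOp β q w) ∧
          ∀ v : LDG.DGSpace N k,
            (∫ x in a..b, (LDG.diffOp β q w x - M.toFun (M.Lh k q β θ (M.ldgProj k q θ w)) x) *
              M.toFun v x) = 0 := by
  obtain ⟨C, hC, hmain⟩ := mainTheorem3_general a b k q hq θ hθ hθ₀
  have hle : k + q ≤ k + 1 + q := by lia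
  refine ⟨C, hC, fun N _ M _ => ⟨(hmain N M).1, fun w hw => ?_⟩⟩
  obtain ⟨hz, herr, hLh⟩ := (hmain N M).2 w (hw.mono hle)
  refine ⟨hz, herr.trans ?_, hLh⟩
  have := LDG.sobolevNorm_mono a b hle w
  have := M.size_pos
  gcongr
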